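/- Let $d\ge 1$ and $m_1,\dots,m_d\ge 1$ be integers, let $\alpha_1,\dots,\alpha_d\in\mathbb{Q}$ with $\alpha_1=0$, and put $$\mathcal{I}=\{(i,s)\;:\;1\le i\le d,\ 1\le s\le m_i+1\}\setminus\{(1,1)\},\qquad M=\#\mathcal{I}=d-1+m_1+\cdots+m_d .$$ For $g\in\mathbb{Q}[[z]]$ write $g(e^z-1)=\sum_{k\ge 0}b_k\,z^k/k!$ and set $\mathcal{M}^{-1}(g)=\sum_{k\ge 0}b_k(-1/z)^{k+1}\in (1/z)\,\mathbb{Q}[[1/z]]$. For $\alpha\in\mathbb{Q}$ define the formal series $$R_{\alpha,1}(z)=\mathcal{M}^{-1}\Big(\frac{(1+z)^\alpha-1}{z}\Big),\qquad R_{\alpha,s}(z)=\mathcal{M}^{-1}\Big(\frac{(1+z)^\alpha\log^{s-1}(1+z)}{z}\Big)\quad(s\ge 2).$$ Writing $R_{\alpha,s}(z)=\sum_{k\ge 0}f_k/z^{k+1}$, let $\varphi_{\alpha,s}:\mathbb{Q}[z,t]\to\mathbb{Q}[z]$ be the $\mathbb{Q}[z]$-linear map with $\varphi_{\alpha,s}(t^k)=f_k$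 for all $k\ge 0$. Let $(z)_k=z(z+1)\cdots(z+k-1)$ and let $\Delta_{-1}$ be the operator $F(z)\mapsto F(z-1)-F(z)$ on $\mathbb{Q}[z]$. For integers $n\ge 0$, $0\le\ell\le M$ and $(i,s)\in\mathcal{I}$ put $$A_{n,\ell}(z)=(-1)^\ell\frac{(z)_\ell}{\ell!}\prod_{j=1}^d\Big((-1)^n\frac{(z+\alpha_j)_n}{n!}\Big)^{m_j+1},\qquad P_{n,\ell}(z)=\Delta_{-1}^n\big(A_{n,\ell}(z)\big),$$ $$Q_{n,i,s,\ell}(z)=\varphi_{\alpha_i,s}\Big(\frac{P_{n,\ell}(z)-P_{n,\ell}(t)}{z-t}\Big).$$ If $M\le 2$, then for every $x\in\mathbb{Q}$, every $(i,s)\in\mathcal{I}$ and every integer $\ell$ with $0\le\ell\le M$, $$\limsup_{n\to\infty}|P_{n,\ell}(x)|^{1/n}\le 1\qquad\text{and}\qquad \limsup_{n\to\infty}|Q_{n,i,s,\ell}(x)|^{1/n}\le 1 .$$ -/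

import Mathlib

namespace PolygammaPade

noncomputable section

open Polynomial

/-- The quotient `(∑ cₖ zᵏ) / z = ∑ cₖ₊₁ zᵏ` of a formal power series without constant term
(the constant coefficient is discarded in general). -/
def divZ (g : PowerSeries ℚ) : PowerSeries ℚ :=
  PowerSeries.mk fun k => PowerSeries.coeff (k + 1) g

/-- The modified inverse Mellin transform `ℚ⟦z⟧ → (1/z) ℚ⟦1/z⟧`:
`g ↦ ∑ bₖ (-1/z)^(k+1)`, where `g(eᶻ - 1) = ∑ bₖ zᵏ / k!`.
An element of `ℚ⟦1/z⟧` is a `PowerSeries ℚ` whose variable stands for `1/z`. -/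
def invMellinT (g : PowerSeries ℚ) : PowerSeries ℚ :=
  PowerSeries.mk fun j => match j with
    | 0 => 0
    | k + 1 => (-1) ^ (k + 1) *
        ((k.factorial : ℚ) * PowerSeries.coeff k (g.subst (PowerSeries.exp ℚ - 1)))

/-- `R_{α,s}`, as a series in `1/z`: the modified inverse Mellin transform of
`(1+z)^α log(1+z)^(s-1) / z` if `s ≥ 2`, and of `((1+z)^α - 1) / z` if `s = 1`.
(Only `s ≥ 1` is meaningful.) -/
def R (α : ℚ) (s : ℕ) : PowerSeries ℚ :=
  if s = 1 then
    invMellinT (divZ (PowerSeries.binomialSeries ℚ α - 1))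
  else
    invMellinT (divZ (PowerSeries.binomialSeries ℚ α * PowerSeries.log ℚ ^ (s - 1)))

/-- The formal `f`-integration transform of `f = ∑ fₖ / z^(k+1)`: the `ℚ[z]`-linear map
`ℚ[z][t] → ℚ[z]` with `tᵏ ↦ fₖ`. In `ℚ[z][t]`, written `ℚ[X][X]`, the outer variable is `t`
and the inner one is `z`. -/
def phi (f : PowerSeries ℚ) (F : ℚ[X][X]) : ℚ[X] :=
  F.sum fun k a => PowerSeries.coeff (k + 1) f • a

/-- The polynomial `(P(z) - P(t)) / (z - t)`, computed as `(P(t) - P(z)) / (t - z)`. -/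
def divDiff (P : ℚ[X]) : ℚ[X][X] :=
  (P.map C - C P) /ₘ (X - C X)

/-- The division in `divDiff` is exact. -/
theorem mul_divDiff (P : ℚ[X]) : (X - C X) * divDiff P = P.map C - C P := by
  unfold divDiff
  rw [mul_divByMonic_eq_iff_isRoot]
  simp [IsRoot, eval_map, eval₂_C_X]

/-- The difference operator `Δ₋₁ : P(z) ↦ P(z - 1) - P(z)`. -/
def delta (P : ℚ[X]) : ℚ[X] :=
  P.comp (X - 1) - P

/-- `M = d - 1 + m₁ + ⋯ + m_d`. -/
def bigM {d : ℕ} (m : Fin d → ℕ) : ℕ :=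
  d - 1 + ∑ i, m i

/-- The index set `{(i, s) : 1 ≤ i ≤ d, 1 ≤ s ≤ mᵢ + 1} \ {(1, 1)}`; the index `i` is shifted
to start at `0`. -/
def indexSet {d : ℕ} [NeZero d] (m : Fin d → ℕ) : Set (Fin d × ℕ) :=
  {p | 1 ≤ p.2 ∧ p.2 ≤ m p.1 + 1 ∧ p ≠ (0, 1)}

/-- `A_{n,ℓ}(z) = (-1)^ℓ (z)_ℓ / ℓ! · ∏ᵢ ((-1)ⁿ (z + αᵢ)_n / n!)^(mᵢ + 1)`, where `(z)_k` is the
rising factorial. -/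
def A {d : ℕ} (m : Fin d → ℕ) (α : Fin d → ℚ) (n l : ℕ) : ℚ[X] :=
  C ((-1) ^ l / (l.factorial : ℚ)) * ascPochhammer ℚ l *
    ∏ i, (C ((-1) ^ n / (n.factorial : ℚ)) *
      (ascPochhammer ℚ n).comp (X + C (α i))) ^ (m i + 1)

/-- `P_{n,ℓ} = Δ₋₁ⁿ (A_{n,ℓ})`. -/
def P {d : ℕ} (m : Fin d → ℕ) (α : Fin d → ℚ) (n l : ℕ) : ℚ[X] :=
  delta^[n] (A m α n l)

/-- `Q_{n,i,s,ℓ}(z) = φ_{αᵢ,s} ((P_{n,ℓ}(z) - P_{n,ℓ}(t)) / (z - t))`, where `φ_{α,s}` is the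
formal integration transform of `R_{α,s}`. -/
def Q {d : ℕ} (m : Fin d → ℕ) (α : Fin d → ℚ) (n : ℕ) (i : Fin d) (s l : ℕ) : ℚ[X] :=
  phi (R (α i) s) (divDiff (P m α n l))

end

end PolygammaPade

namespace PolygammaPade

noncomputable section

open Polynomial

/-! Since `d - 1 + ∑ mᵢ ≥ 2d - 1`, the bound `M ≤ 2` leaves only `d = 1`, `m₁ ≤ 2`, `α₁ = 0` and `s
∈ {2, 3}`. In these cases `P` and `Q` at a fixed point grow at most polynomially in `n`, which is
more than the limsup needs.

Put `y = -z`, `k = n - j` and `B = binom(y + j, n)`. Expanding the `n`-th difference gives `P = ∑ⱼ ±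
binom(n, j) / l! · fallProd j l · B^(m₁ + 1)`. At a fixed point `|B|` is at most a polynomial in `n`
divided by `binom(n, j)`, so one factor `B` absorbs the binomial coefficient
(`choose_mul_abs_eval_binomShift_le`).

For `Q`, replace `binom(y, k)` by `u^k`. Then `φ` becomes, up to sign, integration over `[-1, 0]`,
with weight `1` for `s = 2` and `2 log((1 + u) / |u|)` for `s = 3` (`phi_invMellinT_eval`). The
divided difference of `B^(r + 1)` is a combination of products of the divided difference of `B` with
`B^i`, `i ≤ r ≤ 2`. Integration by parts moves the first factor to the other side
(`unitInt_mellinPoly_mul`, `logInt_mellinPoly_mul`), where a product `binProd a b` has sup norm at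
most `a! b!`. The power `B^i` becomes `1`, `u^k (1 + u)^j`, or the latter times a shifted Legendre
polynomial, all bounded by `1` on `[-1, 0]`; this is where `m₁ ≤ 2` enters. Finally `binom(n, j) j!
k! / n! = 1` removes the exponential growth. -/

/-! ### The operator model of polynomials in the binomial basis -/

/-- Multiplication by `y` on `ℝ[y]`, in coordinates where `binom(y, k)` corresponds to `Xᵏ`. -/
def mellinOp : Module.End ℝ ℝ[X] where
  toFun f := X * derivative ((1 + X) * f)
  map_add' f g := by simp only [mul_add, derivative_add]
  map_smul' c f := by simp only [mul_smul_comm, derivative_smul, RingHom.id_apply]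

theorem mellinOp_apply (f : ℝ[X]) : mellinOp f = X * derivative ((1 + X) * f) := rfl

/-- The image of `1` under the polynomial `p` in `mellinOp`: it replaces `binom(y, k)` by `Xᵏ`. -/
def mellinPoly (p : ℝ[X]) : ℝ[X] := aeval mellinOp p 1

theorem mellinPoly_add (p q : ℝ[X]) : mellinPoly (p + q) = mellinPoly p + mellinPoly q := by
  simp [mellinPoly]

theorem mellinPoly_smul (c : ℝ) (p : ℝ[X]) : mellinPoly (c • p) = c • mellinPoly p := by
  simp [mellinPoly]

theorem mellinPoly_one : mellinPoly 1 = 1 := by simp [mellinPoly]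

theorem mellinPoly_mul (p q : ℝ[X]) : mellinPoly (p * q) = aeval mellinOp p (mellinPoly q) := by
  simp [mellinPoly]

/-- The product `(y + 1) ⋯ (y + a) · y (y - 1) ⋯ (y - b + 1)`. -/
def binProd (a b : ℕ) : ℝ[X] :=
  (∏ i ∈ Finset.range a, (X + C ((i : ℝ) + 1))) * ∏ i ∈ Finset.range b, (X - C (i : ℝ))

theorem binProd_zero : binProd 0 0 = 1 := by simp [binProd]

theorem binProd_succ_left (a b : ℕ) :
    binProd (a + 1) b = (X + C ((a : ℝ) + 1)) * binProd a b := by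
  simp only [binProd, Finset.prod_range_succ]; ring

theorem binProd_succ_right (a b : ℕ) :
    binProd a (b + 1) = (X - C (b : ℝ)) * binProd a b := by
  simp only [binProd, Finset.prod_range_succ]; ring

theorem iterate_derivative_one_add_X_mul (n : ℕ) (f : ℝ[X]) :
    derivative^[n + 1] ((1 + X) * f) =
      (1 + X) * derivative^[n + 1] f + C ((n : ℝ) + 1) * derivative^[n] f := by
  have h := iterate_derivative_mul_X (n := n + 1) f
  simp only [add_tsub_cancel_right, nsmul_eq_mul] at h
  rw [add_mul, one_mul, mul_comm X f, iterate_map_add, h]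
  simp
  ring

theorem iterate_derivative_X_mul' (n : ℕ) (f : ℝ[X]) :
    derivative^[n + 1] (X * f) =
      X * derivative^[n + 1] f + C ((n : ℝ) + 1) * derivative^[n] f := by
  have h := iterate_derivative_mul_X (n := n + 1) f
  simp only [add_tsub_cancel_right, nsmul_eq_mul] at h
  rw [mul_comm X f, h]
  simp
  ring

theorem mellinOp_X_pow_mul (a b : ℕ) (G : ℝ[X]) :
    mellinOp (X ^ b * (1 + X) ^ a * G) =
      X ^ b * (1 + X) ^ a * (C (b : ℝ) * (1 + X) * G + C ((a : ℝ) + 1) * X * G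
        + X * (1 + X) * derivative G) := by
  rw [mellinOp_apply]
  have h : (1 + X : ℝ[X]) * (X ^ b * (1 + X) ^ a * G) = X ^ b * ((1 + X) ^ (a + 1) * G) := by ring
  rw [h, derivative_mul, derivative_mul, derivative_X_pow, derivative_pow_succ]
  simp only [derivative_add, derivative_one, derivative_X, zero_add, mul_one, map_natCast]
  rcases b with _ | b
  · simp; ring
  · simp only [Nat.cast_add, Nat.cast_one, add_tsub_cancel_right]
    simp
    ring

/-- A Rodrigues-type formula. -/
theorem aeval_binProd (a b : ℕ) (f : ℝ[X]) :
    aeval mellinOp (binProd a b) f =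
      X ^ b * (1 + X) ^ a * derivative^[a + b] (X ^ a * (1 + X) ^ b * f) := by
  induction a with
  | zero =>
    induction b generalizing f with
    | zero => simp [binProd_zero]
    | succ b ih =>
      rw [binProd_succ_right, map_mul, Module.End.mul_apply, ih]
      have e : (X : ℝ[X]) ^ 0 * (1 + X) ^ (b + 1) * f = (1 + X) * (X ^ 0 * (1 + X) ^ b * f) := by
        ring
      rw [e, ← add_assoc, iterate_derivative_one_add_X_mul, map_sub, aeval_X, aeval_C,
        LinearMap.sub_apply, mellinOp_X_pow_mul, Module.algebraMap_end_apply, smul_eq_C_mul,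
        ← Function.iterate_succ_apply' derivative]
      push_cast
      simp
      ring
  | succ a ih =>
      rw [binProd_succ_left, map_mul, Module.End.mul_apply, ih]
      have e : (X : ℝ[X]) ^ (a + 1) * (1 + X) ^ b * f = X * (X ^ a * (1 + X) ^ b * f) := by
        ring
      rw [e, add_right_comm, iterate_derivative_X_mul', map_add, aeval_X, aeval_C,
        LinearMap.add_apply, mellinOp_X_pow_mul, Module.algebraMap_end_apply, smul_eq_C_mul,
        ← Function.iterate_succ_apply' derivative]
      push_cast
      simp
      ring

theorem mellinPoly_binProd (a b : ℕ) :
    mellinPoly (binProd a b) = C ((a + b).factorial : ℝ) * (X ^ b * (1 + X) ^ a) := by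
  induction a with
  | zero =>
    induction b with
    | zero => simp [binProd_zero, mellinPoly_one]
    | succ b ih =>
      rw [binProd_succ_right, mellinPoly_mul, ih, ← smul_eq_C_mul, map_smul, map_sub, aeval_X,
        aeval_C, LinearMap.sub_apply, Module.algebraMap_end_apply,
        ← mul_one (X ^ b * (1 + X) ^ 0 : ℝ[X]), mellinOp_X_pow_mul, ← add_assoc,
        Nat.factorial_succ]
      simp [smul_eq_C_mul]
      ring
  | succ a ih =>
    rw [binProd_succ_left, mellinPoly_mul, ih, ← smul_eq_C_mul, map_smul, map_add, aeval_X,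
        aeval_C, LinearMap.add_apply, Module.algebraMap_end_apply,
        ← mul_one (X ^ b * (1 + X) ^ a : ℝ[X]), mellinOp_X_pow_mul, add_right_comm a 1 b,
        Nat.factorial_succ]
    simp [smul_eq_C_mul]
    ring

/-- The reflection `y ↦ -1 - y` exchanges the two kinds of factors. It is the symmetry induced by
the adjoint of `mellinOp`, which is `-1 - mellinOp`. -/
theorem binProd_comp (a b : ℕ) :
    (binProd a b).comp (-1 - X) = (-1) ^ (a + b) * binProd b a := by
  induction a with
  | zero =>
    induction b with
    | zero => simp [binProd_zero]
    | succ b ih =>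
      rw [binProd_succ_right, mul_comp, ih, binProd_succ_left]
      simp
      ring
  | succ a ih =>
      rw [binProd_succ_left, mul_comp, ih, binProd_succ_right]
      simp
      ring

theorem mellinPoly_binProd_comp (a b : ℕ) :
    mellinPoly ((binProd a b).comp (-1 - X)) =
      (-1 : ℝ) ^ (a + b) • (C ((a + b).factorial : ℝ) * (X ^ a * (1 + X) ^ b)) := by
  rw [binProd_comp, add_comm a b, ← mellinPoly_binProd, ← mellinPoly_smul, smul_eq_C_mul]
  simp

/-! ### The two integrals and their moments -/

/-- Integration of a polynomial over `[-1, 0]`. -/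
def unitInt : ℝ[X] →ₗ[ℝ] ℝ where
  toFun f := ∫ u in (-1 : ℝ)..0, f.eval u
  map_add' f g := by
    simp only [eval_add]
    exact intervalIntegral.integral_add (f.continuous.intervalIntegrable _ _)
      (g.continuous.intervalIntegrable _ _)
  map_smul' c f := by simp

theorem unitInt_apply (f : ℝ[X]) : unitInt f = ∫ u in (-1 : ℝ)..0, f.eval u := rfl

/-- The weight `2 log ((1 + u) / |u|)`. -/
def logWeight (u : ℝ) : ℝ := 2 * (Real.log (1 + u) - Real.log u)

theorem intervalIntegrable_log_one_add :
    IntervalIntegrable (fun u : ℝ => Real.log (1 + u)) MeasureTheory.volume (-1) 0 := by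
  have := (intervalIntegral.intervalIntegrable_log' (a := 0) (b := 1)).comp_add_left (c := 1)
  simpa using this

theorem intervalIntegrable_logWeight :
    IntervalIntegrable logWeight MeasureTheory.volume (-1) 0 :=
  (intervalIntegrable_log_one_add.sub intervalIntegral.intervalIntegrable_log').const_mul 2

theorem intervalIntegrable_mul_logWeight (f : ℝ[X]) :
    IntervalIntegrable (fun u => f.eval u * logWeight u) MeasureTheory.volume (-1) 0 :=
  intervalIntegrable_logWeight.continuousOn_mul f.continuous.continuousOn

/-- Integration of a polynomial over `[-1, 0]` with the weight `logWeight`. -/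
def logInt : ℝ[X] →ₗ[ℝ] ℝ where
  toFun f := ∫ u in (-1 : ℝ)..0, f.eval u * logWeight u
  map_add' f g := by
    simp only [eval_add, add_mul]
    exact intervalIntegral.integral_add (intervalIntegrable_mul_logWeight f)
      (intervalIntegrable_mul_logWeight g)
  map_smul' c f := by
    simp [mul_assoc]

theorem logInt_apply (f : ℝ[X]) :
    logInt f = ∫ u in (-1 : ℝ)..0, f.eval u * logWeight u := rfl

theorem unitInt_derivative (q : ℝ[X]) : unitInt (derivative (X * (1 + X) * q)) = 0 := by
  rw [unitInt_apply, intervalIntegral.integral_eq_sub_of_hasDerivAt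
    (fun u _ => (X * (1 + X) * q).hasDerivAt u)
    ((derivative (X * (1 + X) * q)).continuous.intervalIntegrable _ _)]
  simp

/-- Integration by parts: `logWeight` has derivative `-2 / (u (1 + u))`, which cancels the factor `X
* (1 + X)`; that factor also kills the boundary terms. -/
theorem logInt_derivative (q : ℝ[X]) :
    logInt (derivative (X * (1 + X) * q)) = 2 * unitInt q := by
  -- Continuity at `-1` and `0`, where the weight is singular, comes from that of `t log t`;
  -- differentiability is then needed only in the open interval.
  have hc : Continuous fun u : ℝ => logWeight u * (X * (1 + X) * q).eval u := by
    have e : (fun u : ℝ => logWeight u * (X * (1 + X) * q).eval u) = fun u =>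
        2 * ((1 + u) * Real.log (1 + u) * (u * q.eval u)
          - u * Real.log u * ((1 + u) * q.eval u)) := by
      funext u; simp [logWeight]; ring
    rw [e]
    have h1 : Continuous fun u : ℝ => (1 + u) * Real.log (1 + u) :=
      Real.continuous_mul_log.comp (continuous_const.add continuous_id)
    have h2 := q.continuous
    have h3 := Real.continuous_mul_log
    fun_prop
  have hd : ∀ u ∈ Set.Ioo (-1 : ℝ) 0, HasDerivAt
      (fun u : ℝ => logWeight u * (X * (1 + X) * q).eval u)
      ((derivative (X * (1 + X) * q)).eval u * logWeight u - (C 2 * q).eval u) u := by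
    intro u hu
    have hu0 : u ≠ 0 := hu.2.ne
    have hu1 : 1 + u ≠ 0 := by linarith [hu.1]
    have hw : HasDerivAt logWeight (2 * (1 / (1 + u) - u⁻¹)) u :=
      ((((hasDerivAt_id u).const_add 1).log hu1).sub (Real.hasDerivAt_log hu0)).const_mul 2
    refine (hw.mul ((X * (1 + X) * q).hasDerivAt u)).congr_deriv ?_
    simp
    field_simp
    ring
  have hi : IntervalIntegrable (fun u => (C (2 : ℝ) * q).eval u) MeasureTheory.volume (-1) 0 :=
    (C (2 : ℝ) * q).continuous.intervalIntegrable _ _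
  have hI := intervalIntegrable_mul_logWeight (derivative (X * (1 + X) * q))
  have key := intervalIntegral.integral_eq_sub_of_hasDerivAt_of_le (by norm_num : (-1 : ℝ) ≤ 0)
    hc.continuousOn hd (hI.sub hi)
  rw [intervalIntegral.integral_sub hI hi, ← logInt_apply, ← unitInt_apply, ← smul_eq_C_mul,
    map_smul] at key
  simp only [eval_mul, eval_X, zero_mul, eval_add, eval_one, add_neg_cancel, mul_zero,
    sub_self, smul_eq_mul] at key
  linarith

theorem unitInt_X_pow (k : ℕ) : unitInt (X ^ k) = (-1) ^ k / ((k : ℝ) + 1) := by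
  rw [unitInt_apply]
  simp [integral_pow, pow_succ]

theorem logInt_one : logInt 1 = 0 := by
  have h1 : ∫ u in (-1 : ℝ)..0, Real.log (1 + u) = ∫ u in (0 : ℝ)..1, Real.log u := by
    rw [intervalIntegral.integral_comp_add_left (fun u => Real.log u)]; norm_num
  have h2 : ∫ u in (-1 : ℝ)..0, Real.log u = ∫ u in (0 : ℝ)..1, Real.log u := by
    simp
  have hi := intervalIntegrable_log_one_add
  simp only [logInt_apply, logWeight, eval_one, one_mul, intervalIntegral.integral_const_mul]
  rw [intervalIntegral.integral_sub hi intervalIntegral.intervalIntegrable_log', h1, h2]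
  simp

/-- With `logInt_one` this recurrence determines all moments; it mirrors `(1 + z) (log² (1 + z))' =
2 log (1 + z)`. -/
theorem logInt_X_pow_succ (k : ℕ) :
    ((k : ℝ) + 2) * logInt (X ^ (k + 1)) + ((k : ℝ) + 1) * logInt (X ^ k) =
      2 * (-1) ^ k / ((k : ℝ) + 1) := by
  have h := logInt_derivative (X ^ k)
  have e : derivative (X * (1 + X) * X ^ k : ℝ[X]) =
      ((k : ℝ) + 2) • X ^ (k + 1) + ((k : ℝ) + 1) • X ^ k := by
    have : (X * (1 + X) * X ^ k : ℝ[X]) = X ^ (k + 1) + X ^ (k + 2) := by ring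
    rw [this, derivative_add, derivative_X_pow, derivative_X_pow, smul_eq_C_mul, smul_eq_C_mul]
    simp
    ring
  rw [e, map_add, map_smul, map_smul, unitInt_X_pow, smul_eq_mul, smul_eq_mul] at h
  rw [h]; ring

theorem abs_unitInt_le {f : ℝ[X]} {K : ℝ} (h : ∀ u ∈ Set.Icc (-1 : ℝ) 0, |f.eval u| ≤ K) :
    |unitInt f| ≤ K := by
  have := intervalIntegral.norm_integral_le_of_norm_le_const (a := (-1 : ℝ)) (b := 0)
    (f := fun u => f.eval u) (C := K) (fun u hu => by
      rw [Set.uIoc_of_le (by norm_num)] at hu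
      exact h u ⟨hu.1.le, hu.2⟩)
  simpa [unitInt_apply] using this

theorem abs_logInt_le {f : ℝ[X]} {K : ℝ} (h : ∀ u ∈ Set.Icc (-1 : ℝ) 0, |f.eval u| ≤ K) :
    |logInt f| ≤ K * ∫ u in (-1 : ℝ)..0, |logWeight u| := by
  rw [← intervalIntegral.integral_const_mul]
  rw [logInt_apply, ← Real.norm_eq_abs]
  refine intervalIntegral.norm_integral_le_of_norm_le (by norm_num) (.of_forall fun u hu => ?_)
    (intervalIntegrable_logWeight.abs.const_mul K)
  rw [Real.norm_eq_abs, abs_mul]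
  exact mul_le_mul_of_nonneg_right (h u ⟨hu.1.le, hu.2⟩) (abs_nonneg _)

/-! ### Adjoints of polynomials in `mellinOp` -/

theorem mul_mellinOp_add (f g : ℝ[X]) :
    derivative (X * (1 + X) * (f * g)) = f * mellinOp g - (-1 - mellinOp) f * g := by
  simp only [LinearMap.sub_apply, LinearMap.neg_apply, Module.End.one_apply, mellinOp_apply,
    derivative_mul, derivative_add, derivative_one, derivative_X]
  ring

theorem unitInt_mul_mellinOp (f g : ℝ[X]) :
    unitInt (f * mellinOp g) = unitInt ((-1 - mellinOp) f * g) := by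
  have h := unitInt_derivative (f * g)
  rw [mul_mellinOp_add, map_sub] at h
  linarith

theorem logInt_mul_mellinOp (f g : ℝ[X]) :
    logInt (f * mellinOp g) = logInt ((-1 - mellinOp) f * g) + 2 * unitInt (f * g) := by
  have h := logInt_derivative (f * g)
  rw [mul_mellinOp_add, map_sub] at h
  linarith

theorem unitInt_mul_aeval (p f g : ℝ[X]) :
    unitInt (f * aeval mellinOp p g) = unitInt (aeval (-1 - mellinOp) p f * g) := by
  induction p using Polynomial.induction_on' generalizing g with
  | add p q hp hq => simp only [map_add, LinearMap.add_apply, mul_add, add_mul, hp, hq]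
  | monomial n a =>
    rw [← smul_X_eq_monomial]
    simp only [map_smul, LinearMap.smul_apply, mul_smul_comm, smul_mul_assoc]
    congr 1
    simp only [map_pow, aeval_X]
    induction n generalizing f g with
    | zero => simp
    | succ n ih =>
      rw [pow_succ', Module.End.mul_apply, unitInt_mul_mellinOp, ih, pow_succ,
        Module.End.mul_apply]

/-- Each `mellinOp` moved across leaves one unweighted integral with that factor deleted. Summed
over the factors of a power, the deletions form the derivative of `p`. -/
theorem logInt_mul_aeval (p f g : ℝ[X]) :
    logInt (f * aeval mellinOp p g) = logInt (aeval (-1 - mellinOp) p f * g) +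
      2 * unitInt (aeval (-1 - mellinOp) (derivative p) f * g) := by
  induction p using Polynomial.induction_on' generalizing g with
  | add p q hp hq =>
    simp only [map_add, LinearMap.add_apply, mul_add, add_mul, hp, hq]
    ring
  | monomial n a =>
    rw [← smul_X_eq_monomial]
    simp only [map_smul, LinearMap.smul_apply, mul_smul_comm, smul_mul_assoc,
      smul_eq_mul, mul_left_comm (2 : ℝ) a, ← mul_add]
    congr 1
    simp only [map_pow, aeval_X]
    induction n generalizing f g with
    | zero => simp
    | succ n ih =>
      have e1 : unitInt ((-1 - mellinOp) f * (mellinOp ^ n) g) =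
          unitInt (f * (mellinOp ^ (n + 1)) g) := by
        rw [pow_succ', Module.End.mul_apply, unitInt_mul_mellinOp]
      have e2 := unitInt_mul_aeval (X ^ n) f g
      simp only [map_pow, aeval_X] at e2
      rw [pow_succ', Module.End.mul_apply, logInt_mul_mellinOp, ih, pow_succ,
        Module.End.mul_apply, e2]
      have e3 : aeval (-1 - mellinOp) (derivative (X ^ (n + 1) : ℝ[X])) f =
          aeval (-1 - mellinOp) (derivative (X ^ n : ℝ[X])) ((-1 - mellinOp) f) +
            ((-1 - mellinOp) ^ n) f := by
        rw [pow_succ X, derivative_mul, derivative_X, mul_one, map_add, LinearMap.add_apply,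
          map_mul, aeval_X, Module.End.mul_apply, map_pow (aeval _) X n, aeval_X]
      rw [e3, add_mul, map_add]
      ring

theorem aeval_neg_one_sub (p f : ℝ[X]) :
    aeval (-1 - mellinOp) p f = aeval mellinOp (p.comp (-1 - X)) f := by
  rw [aeval_comp]
  simp

/-- The image of `1` under the adjoint of the polynomial `p` in `mellinOp`. -/
def mellinPolyAdj (p : ℝ[X]) : ℝ[X] := mellinPoly (p.comp (-1 - X))

theorem unitInt_mellinPoly_mul (p q : ℝ[X]) :
    unitInt (mellinPoly (p * q)) = unitInt (mellinPolyAdj p * mellinPoly q) := by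
  rw [mellinPoly_mul, ← one_mul (aeval mellinOp p (mellinPoly q)), unitInt_mul_aeval,
    aeval_neg_one_sub]
  rfl

theorem logInt_mellinPoly_mul (p q : ℝ[X]) :
    logInt (mellinPoly (p * q)) = logInt (mellinPolyAdj p * mellinPoly q) +
      2 * unitInt (mellinPolyAdj (derivative p) * mellinPoly q) := by
  rw [mellinPoly_mul, ← one_mul (aeval mellinOp p (mellinPoly q)), logInt_mul_aeval,
    aeval_neg_one_sub, aeval_neg_one_sub]
  rfl

/-! ### Uniform bounds on `[-1, 0]` -/

theorem iteratedDeriv_polynomial_eval (p : ℂ[X]) (n : ℕ) :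
    iteratedDeriv n (fun z => p.eval z) = fun z => (derivative^[n] p).eval z := by
  induction n generalizing p with
  | zero => simp
  | succ n ih =>
    rw [iteratedDeriv_succ', Function.iterate_succ_apply, ← ih]
    congr 1
    funext z
    exact p.deriv

/-- For `z = u + R e^{iθ}`, the relation `u (1 + u) = -R²` gives `|z (1 + z)|² = R² (1 - 4R² cos²
θ)`. -/
theorem norm_mul_one_add_le {u : ℝ} {R : ℝ} (hR : R ^ 2 = -(u * (1 + u))) (hR0 : 0 ≤ R) {z : ℂ}
    (hz : ‖z - u‖ = R) : ‖z * (1 + z)‖ ≤ R := by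
  obtain ⟨w, rfl⟩ : ∃ w, z = u + w := ⟨z - u, by ring⟩
  rw [add_sub_cancel_left] at hz
  have hw : w.re ^ 2 + w.im ^ 2 = R ^ 2 := by
    rw [← hz, Complex.sq_norm, Complex.normSq_apply]; ring
  refine le_of_sq_le_sq ?_ hR0
  rw [Complex.sq_norm, Complex.normSq_apply]
  simp only [Complex.mul_re, Complex.mul_im, Complex.add_re, Complex.add_im, Complex.ofReal_re,
    Complex.ofReal_im, Complex.one_re, Complex.one_im]
  have h1 : w.im ^ 2 ≤ R ^ 2 := by nlinarith [sq_nonneg w.re]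
  have hu : u * (1 + u) = -(w.re ^ 2 + w.im ^ 2) := by linarith
  have e1 : (u + w.re) * (1 + (u + w.re)) - (0 + w.im) * (0 + (0 + w.im)) =
      (1 + 2 * u) * w.re - 2 * w.im ^ 2 := by linear_combination hu
  rw [e1]
  have e2 : ((1 + 2 * u) * w.re - 2 * w.im ^ 2) * ((1 + 2 * u) * w.re - 2 * w.im ^ 2) +
      ((u + w.re) * (0 + (0 + w.im)) + (0 + w.im) * (1 + (u + w.re))) *
        ((u + w.re) * (0 + (0 + w.im)) + (0 + w.im) * (1 + (u + w.re))) =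
      R ^ 2 * (1 - 4 * R ^ 2 + 4 * w.im ^ 2) := by
    rw [← hw]; linear_combination (4 * (w.re ^ 2 + w.im ^ 2)) * hu
  rw [e2]
  nlinarith [sq_nonneg R]

/-- The bound `|Pₙ| ≤ 1` for Legendre polynomials, shifted to `[-1, 0]`. -/
theorem abs_eval_iterate_derivative_le (n : ℕ) {u : ℝ} (hu : u ∈ Set.Icc (-1 : ℝ) 0) :
    |(derivative^[n] ((X * (1 + X)) ^ n : ℝ[X])).eval u| ≤ n.factorial := by
  -- Cauchy's estimate on the circle of radius `√(-u (1 + u))`, on which the function is at most the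
  -- `n`-th power of the radius. The circle degenerates at the endpoints, which are reached by
  -- closure.
  have key : Set.Ioo (-1 : ℝ) 0 ⊆
      {u | |(derivative^[n] ((X * (1 + X)) ^ n : ℝ[X])).eval u| ≤ n.factorial} := by
    intro u hu
    have hpos : 0 < -(u * (1 + u)) := by nlinarith [hu.1, hu.2]
    have hR : 0 < √(-(u * (1 + u))) := Real.sqrt_pos.2 hpos
    have h := Complex.norm_iteratedDeriv_le_of_forall_mem_sphere_norm_le (c := (u : ℂ))
      (f := fun z => ((X * (1 + X)) ^ n : ℂ[X]).eval z) (C := √(-(u * (1 + u))) ^ n) n hR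
      (Polynomial.differentiable _).diffContOnCl (fun z hz => by
        simp only [eval_pow, eval_mul, eval_X, eval_add, eval_one, norm_pow]
        exact pow_le_pow_left₀ (norm_nonneg _) (norm_mul_one_add_le (Real.sq_sqrt hpos.le) hR.le
          (by simpa [dist_eq_norm] using hz)) n)
    rw [mul_div_assoc, div_self (pow_ne_zero n hR.ne'), mul_one,
      iteratedDeriv_polynomial_eval] at h
    beta_reduce at h
    have e : ((X * (1 + X)) ^ n : ℂ[X]) = ((X * (1 + X)) ^ n : ℝ[X]).map Complex.ofRealHom := by
      simp
    rw [e, iterate_derivative_map, ← Complex.ofRealHom_eq_coe, eval_map_apply,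
      Complex.ofRealHom_eq_coe, Complex.norm_real] at h
    exact h
  have hcl : IsClosed {u : ℝ |
      |(derivative^[n] ((X * (1 + X)) ^ n : ℝ[X])).eval u| ≤ n.factorial} :=
    isClosed_le (Polynomial.continuous _).abs continuous_const
  have := closure_minimal key hcl
  rw [closure_Ioo (by norm_num)] at this
  exact this hu

theorem abs_pow_mul_le_one (a b : ℕ) {u : ℝ} (hu : u ∈ Set.Icc (-1 : ℝ) 0) :
    |u ^ b * (1 + u) ^ a| ≤ 1 := by
  have h1 : |u| ≤ 1 := abs_le.2 ⟨hu.1, by linarith [hu.2]⟩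
  have h2 : |1 + u| ≤ 1 := abs_le.2 ⟨by linarith [hu.1], by linarith [hu.2]⟩
  rw [abs_mul, abs_pow, abs_pow]
  exact mul_le_one₀ (pow_le_one₀ (abs_nonneg _) h1) (by positivity)
    (pow_le_one₀ (abs_nonneg _) h2)

/-- The left side divided by `a! b!` is a single nonnegative term in the binomial expansion of
`((-u) + (1 + u))^(a + b) = 1`. -/
theorem factorial_mul_abs_pow_mul_le (a b : ℕ) {u : ℝ} (hu : u ∈ Set.Icc (-1 : ℝ) 0) :
    ((a + b).factorial : ℝ) * |u ^ a * (1 + u) ^ b| ≤ a.factorial * b.factorial := by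
  have h0 : |u| = -u := abs_of_nonpos hu.2
  have h1 : |1 + u| = 1 + u := abs_of_nonneg (by linarith [hu.1])
  have h2 : 0 ≤ -u := by linarith [hu.2]
  have h3 : 0 ≤ 1 + u := by linarith [hu.1]
  have hs : ((-u) + (1 + u)) ^ (a + b) = 1 := by rw [neg_add_cancel_comm_assoc, one_pow]
  rw [add_pow] at hs
  have ht : (-u) ^ a * (1 + u) ^ b * ((a + b).choose a : ℝ) ≤ 1 := by
    refine le_trans ?_ hs.le
    have := Finset.single_le_sum (s := Finset.range (a + b + 1))
      (f := fun m => (-u) ^ m * (1 + u) ^ (a + b - m) * ((a + b).choose m : ℝ))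
      (fun i _ => by positivity) (Finset.mem_range.2 (by omega : a < a + b + 1))
    simpa using this
  have hc := Nat.add_choose_mul_factorial_mul_factorial a b
  rw [← Nat.choose_symm_add] at hc
  rw [abs_mul, abs_pow, abs_pow, h0, h1, ← hc]
  push_cast
  have := mul_le_mul_of_nonneg_right ht
    (by positivity : (0 : ℝ) ≤ (a.factorial : ℝ) * b.factorial)
  linarith

theorem abs_eval_mellinPolyAdj_binProd_le (a b : ℕ) {u : ℝ} (hu : u ∈ Set.Icc (-1 : ℝ) 0) :
    |(mellinPolyAdj (binProd a b)).eval u| ≤ a.factorial * b.factorial := by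
  rw [mellinPolyAdj, mellinPoly_binProd_comp]
  refine le_trans (le_of_eq ?_) (factorial_mul_abs_pow_mul_le a b hu)
  simp [abs_mul]

/-- The polynomial `binom(y + j, j + k)`. -/
def binomShift (j k : ℕ) : ℝ[X] := ((j + k).factorial : ℝ)⁻¹ • binProd j k

theorem mellinPoly_binomShift (j k : ℕ) : mellinPoly (binomShift j k) = X ^ k * (1 + X) ^ j := by
  rw [binomShift, mellinPoly_smul, mellinPoly_binProd, ← smul_eq_C_mul, smul_smul,
    inv_mul_cancel₀ (by positivity), one_smul]

theorem abs_eval_mellinPoly_binomShift_pow_le (j k : ℕ) {i : ℕ} (hi : i ≤ 2) {u : ℝ}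
    (hu : u ∈ Set.Icc (-1 : ℝ) 0) : |(mellinPoly (binomShift j k ^ i)).eval u| ≤ 1 := by
  have h1 := abs_pow_mul_le_one j k hu
  interval_cases i
  · simp [mellinPoly_one]
  · rw [pow_one, mellinPoly_binomShift]
    simpa using h1
  -- The Rodrigues-type formula applied to `X^k (1 + X)^j` completes the differentiated factor to
  -- `(X (1 + X))^(j + k)`: a shifted Legendre polynomial, up to the factorial.
  · have e : mellinPoly (binomShift j k ^ 2) = ((j + k).factorial : ℝ)⁻¹ •
        (X ^ k * (1 + X) ^ j * derivative^[j + k] ((X * (1 + X)) ^ (j + k))) := by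
      rw [pow_two, mellinPoly_mul, mellinPoly_binomShift, binomShift, map_smul,
        LinearMap.smul_apply, aeval_binProd]
      congr 4
      rw [mul_pow, pow_add, pow_add]
      ring
    have h2 := abs_eval_iterate_derivative_le (j + k) hu
    rw [e, eval_smul, eval_mul, smul_eq_mul, abs_mul, abs_mul, abs_inv, Nat.abs_cast]
    have h3 : |(X ^ k * (1 + X) ^ j : ℝ[X]).eval u| ≤ 1 := by simpa using h1
    have hf : (0 : ℝ) < (j + k).factorial := by positivity
    rw [inv_mul_le_iff₀ hf, mul_one]
    calc _ ≤ 1 * ((j + k).factorial : ℝ) := mul_le_mul h3 h2 (abs_nonneg _) zero_le_one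
      _ = _ := one_mul _

/-! ### Weighted norms in terms of the products `binProd` -/

/-- `ProdBound N K p` says that `p` is a linear combination of products `binProd a b` with
`a, b ≤ N` whose coefficients, weighted with `a! b!`, have absolute values of sum at most `K`. -/
inductive ProdBound (N : ℕ) : ℝ → ℝ[X] → Prop
  | binProd {a b : ℕ} (ha : a ≤ N) (hb : b ≤ N) :
      ProdBound N (a.factorial * b.factorial) (binProd a b)
  | zero : ProdBound N 0 0
  | add {K L : ℝ} {p q : ℝ[X]} (hp : ProdBound N K p) (hq : ProdBound N L q) :
      ProdBound N (K + L) (p + q)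
  | smul (c : ℝ) {K : ℝ} {p : ℝ[X]} (hp : ProdBound N K p) : ProdBound N (|c| * K) (c • p)
  | mono {K L : ℝ} {p : ℝ[X]} (hp : ProdBound N K p) (h : K ≤ L) : ProdBound N L p

theorem ProdBound.nonneg {N : ℕ} {K : ℝ} {p : ℝ[X]} (h : ProdBound N K p) : 0 ≤ K := by
  induction h with
  | binProd => positivity
  | zero => exact le_rfl
  | add _ _ h1 h2 => exact add_nonneg h1 h2
  | smul c _ h => positivity
  | mono _ h ih => exact ih.trans h

theorem ProdBound.sum {N : ℕ} {K : ℝ} {ι : Type*} (s : Finset ι) {p : ι → ℝ[X]}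
    (h : ∀ i ∈ s, ProdBound N K (p i)) : ProdBound N (s.card * K) (∑ i ∈ s, p i) := by
  classical
  induction s using Finset.induction_on with
  | empty => simpa using ProdBound.zero
  | insert a s ha ih =>
    rw [Finset.sum_insert ha, Finset.card_insert_of_notMem ha]
    refine ((h a (by simp)).add (ih fun i hi => h i (by simp [hi]))).mono (le_of_eq ?_)
    push_cast; ring

theorem ProdBound.mono_left {N N' : ℕ} (hN : N ≤ N') {K : ℝ} {p : ℝ[X]} (h : ProdBound N K p) :
    ProdBound N' K p := by
  induction h with
  | binProd ha hb => exact .binProd (ha.trans hN) (hb.trans hN)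
  | zero => exact .zero
  | add _ _ h1 h2 => exact h1.add h2
  | smul c _ h => exact h.smul c
  | mono _ h ih => exact ih.mono h

theorem ProdBound.abs_eval_mellinPolyAdj_le {N : ℕ} {K : ℝ} {p : ℝ[X]} (h : ProdBound N K p)
    {u : ℝ} (hu : u ∈ Set.Icc (-1 : ℝ) 0) : |(mellinPolyAdj p).eval u| ≤ K := by
  induction h with
  | binProd ha hb => exact abs_eval_mellinPolyAdj_binProd_le _ _ hu
  | zero => simp [mellinPolyAdj, mellinPoly]
  | add _ _ h1 h2 =>
    rw [mellinPolyAdj, add_comp, mellinPoly_add, eval_add]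
    exact (abs_add_le _ _).trans (add_le_add h1 h2)
  | smul c _ h =>
    rw [mellinPolyAdj, smul_comp, mellinPoly_smul, eval_smul, smul_eq_mul, abs_mul]
    exact mul_le_mul_of_nonneg_left h (abs_nonneg c)
  | mono _ h ih => exact ih.trans h

theorem ProdBound.X_mul {N : ℕ} {K : ℝ} {p : ℝ[X]} (h : ProdBound N K p) :
    ProdBound (N + 1) ((2 * N + 1) * K) (X * p) := by
  induction h with
  | @binProd a b ha hb =>
    have e : X * PolygammaPade.binProd a b =
        PolygammaPade.binProd a (b + 1) + (b : ℝ) • PolygammaPade.binProd a b := by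
      rw [binProd_succ_right, smul_eq_C_mul]; ring
    rw [e]
    have h1 : ProdBound (N + 1) _ _ := .binProd (ha.trans N.le_succ) (Nat.succ_le_succ hb)
    have h2 : ProdBound (N + 1) _ _ := .binProd (ha.trans N.le_succ) (hb.trans N.le_succ)
    refine (h1.add (h2.smul (b : ℝ))).mono ?_
    have hb' : (b : ℝ) ≤ N := by exact_mod_cast hb
    rw [Nat.abs_cast, Nat.factorial_succ]
    push_cast
    have : (0 : ℝ) ≤ a.factorial * b.factorial := by positivity
    nlinarith
  | zero => simpa using ProdBound.zero
  | add _ _ h1 h2 =>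
    rw [mul_add X]; exact (h1.add h2).mono (le_of_eq (by ring))
  | smul c _ h =>
    rw [mul_smul_comm]; exact (h.smul c).mono (le_of_eq (by ring))
  | mono _ h ih => exact ih.mono (by gcongr)

theorem ProdBound.X_add_C_mul {N : ℕ} {K : ℝ} {p : ℝ[X]} (h : ProdBound N K p) (c : ℝ) :
    ProdBound (N + 1) ((2 * N + 1 + |c|) * K) ((X + C c) * p) := by
  rw [add_mul X, ← smul_eq_C_mul]
  exact (h.X_mul.add ((h.mono_left N.le_succ).smul c)).mono (le_of_eq (by ring))

theorem binProd_eq_mul (a b : ℕ) : binProd a b = binProd a 0 * binProd 0 b := by simp [binProd]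

/-- Conceptually, `∑ binProd a 0 · t^a / a! = (1 - t)^(-y-1)`, and differentiation in `y` multiplies
this by `-log (1 - t) = ∑ t^r / r`. -/
theorem derivative_binProd_zero_right (a : ℕ) :
    derivative (binProd a 0) = ∑ i ∈ Finset.range a,
      ((a.factorial : ℝ) / (i.factorial * (a - i))) • binProd i 0 := by
  induction a with
  | zero => simp [binProd_zero]
  | succ a ih =>
    -- Split `X + a + 1 = (X + i + 1) + (a - i)`: the first part raises the index, the second
    -- cancels the denominator.
    have e1 : ∀ i ∈ Finset.range a, (X + C ((a : ℝ) + 1)) *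
        (((a.factorial : ℝ) / (i.factorial * (a - i))) • binProd i 0) =
        ((a.factorial : ℝ) / (i.factorial * (a - i))) • binProd (i + 1) 0 +
          ((a.factorial : ℝ) / i.factorial) • binProd i 0 := by
      intro i hi
      have h0 : (a : ℝ) - i ≠ 0 := by
        have : (i : ℝ) < a := by exact_mod_cast Finset.mem_range.1 hi
        linarith
      have h1 : (a.factorial : ℝ) / i.factorial =
          (a.factorial : ℝ) / (i.factorial * (a - i)) * (a - i) := by field_simp
      rw [binProd_succ_left, h1]
      simp only [smul_eq_C_mul, C_mul, C_sub, C_add, C_1]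
      ring
    have e2 : ∀ i ∈ Finset.range a,
        (((a + 1).factorial : ℝ) / ((i + 1).factorial * ((a + 1 : ℕ) - (i + 1 : ℕ)))) •
          binProd (i + 1) 0 =
        ((a.factorial : ℝ) / (i.factorial * (a - i))) • binProd (i + 1) 0 +
          ((a.factorial : ℝ) / (i + 1).factorial) • binProd (i + 1) 0 := by
      intro i hi
      have h0 : (a : ℝ) - i ≠ 0 := by
        have : (i : ℝ) < a := by exact_mod_cast Finset.mem_range.1 hi
        linarith
      rw [← add_smul]
      congr 1
      have h2 : ((a + 1 : ℕ) : ℝ) - (i + 1 : ℕ) = a - i := by push_cast; ring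
      rw [h2, Nat.factorial_succ, Nat.factorial_succ]
      push_cast
      field_simp
      ring
    have e3 : ∑ i ∈ Finset.range a, ((a.factorial : ℝ) / (i + 1).factorial) • binProd (i + 1) 0 +
        ((a.factorial : ℝ) / Nat.factorial 0) • binProd 0 0 =
        ∑ i ∈ Finset.range a, ((a.factorial : ℝ) / i.factorial) • binProd i 0 + binProd a 0 := by
      rw [← Finset.sum_range_succ' fun i => ((a.factorial : ℝ) / i.factorial) • binProd i 0,
        Finset.sum_range_succ, div_self (by positivity), one_smul]
    have e4 : ((a + 1).factorial : ℝ) / (Nat.factorial 0 * ((a + 1 : ℕ) - (0 : ℕ))) =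
        (a.factorial : ℝ) / Nat.factorial 0 := by
      rw [Nat.factorial_succ]; push_cast; field_simp; ring
    rw [binProd_succ_left, derivative_mul, ih, Finset.mul_sum, Finset.sum_congr rfl e1,
      Finset.sum_range_succ', Finset.sum_congr rfl e2, e4, Finset.sum_add_distrib,
      Finset.sum_add_distrib, add_assoc, e3]
    simp
    ring

theorem derivative_binProd_zero_left (b : ℕ) :
    ∃ c : ℕ → ℝ, (∀ i ∈ Finset.range b, |c i| = (b.factorial : ℝ) / (i.factorial * (b - i))) ∧
      derivative (binProd 0 b) = ∑ i ∈ Finset.range b, c i • binProd 0 i := by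
  refine ⟨fun i => -((-1) ^ (b + i) * ((b.factorial : ℝ) / (i.factorial * (b - i)))), ?_, ?_⟩
  · intro i hi
    have h0 : (0 : ℝ) ≤ b - i := by
      have : (i : ℝ) < b := by exact_mod_cast Finset.mem_range.1 hi
      linarith
    rw [abs_neg, abs_mul, abs_pow, abs_neg, abs_one, one_pow, one_mul, abs_of_nonneg]
    positivity
  · have e : binProd 0 b = (-1 : ℝ) ^ b • (binProd b 0).comp (-1 - X) := by
      rw [binProd_comp, smul_eq_C_mul, ← mul_assoc]
      simp [← mul_pow]
    rw [e, derivative_smul, derivative_comp, derivative_binProd_zero_right]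
    simp only [sum_comp, smul_comp, binProd_comp, Finset.smul_sum, Finset.mul_sum]
    refine Finset.sum_congr rfl fun i _ => ?_
    simp only [smul_eq_C_mul, C_neg, C_mul, C_pow, C_1]
    simp
    ring

/-- The weights `a! b!` are chosen for this: every term of the derivative of `binProd a b` has
weighted size at most `a! b!`, and there are `a + b ≤ 2N` terms. -/
theorem ProdBound.derivative {N : ℕ} {K : ℝ} {p : ℝ[X]} (h : ProdBound N K p) :
    ProdBound N (2 * N * K) (derivative p) := by
  have key : ∀ (a i : ℕ), i < a →
      (a.factorial : ℝ) / (i.factorial * (a - i)) * i.factorial ≤ a.factorial := by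
    intro a i hi
    have h0 : (1 : ℝ) ≤ a - i := by
      have : (i : ℝ) + 1 ≤ a := by exact_mod_cast hi
      linarith
    have e : (a.factorial : ℝ) / (i.factorial * (a - i)) * i.factorial =
        a.factorial / (a - i) := by field_simp
    rw [e]
    exact div_le_self (by positivity) h0
  induction h with
  | @binProd a b ha hb =>
    obtain ⟨c, hc, hF⟩ := derivative_binProd_zero_left b
    have e : Polynomial.derivative (PolygammaPade.binProd a b) =
        ∑ i ∈ Finset.range a, ((a.factorial : ℝ) / (i.factorial * (a - i))) •
          PolygammaPade.binProd i b + ∑ i ∈ Finset.range b, c i • PolygammaPade.binProd a i := by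
      rw [binProd_eq_mul, derivative_mul, derivative_binProd_zero_right, hF, Finset.sum_mul,
        Finset.mul_sum]
      congr 1 <;> refine Finset.sum_congr rfl fun i _ => ?_
      · rw [smul_mul_assoc, ← binProd_eq_mul]
      · rw [mul_smul_comm, ← binProd_eq_mul]
    rw [e]
    have h1 : ProdBound N _ _ := ProdBound.sum (N := N) (Finset.range a)
      (K := a.factorial * b.factorial)
      (p := fun i => ((a.factorial : ℝ) / (i.factorial * (a - i))) • PolygammaPade.binProd i b)
      fun i hi => by
        rw [Finset.mem_range] at hi
        have h0 : ProdBound N _ _ := .binProd (hi.le.trans ha) hb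
        refine (h0.smul _).mono ?_
        have h1 : (0 : ℝ) ≤ a - i := by
          have : (i : ℝ) < a := by exact_mod_cast hi
          linarith
        rw [abs_of_nonneg (by positivity), ← mul_assoc]
        exact mul_le_mul_of_nonneg_right (key a i hi) (by positivity)
    have h2 : ProdBound N _ _ := ProdBound.sum (N := N) (Finset.range b)
      (K := a.factorial * b.factorial) (p := fun i => c i • PolygammaPade.binProd a i)
      fun i hi => by
        have hi' := Finset.mem_range.1 hi
        have h0 : ProdBound N _ _ := .binProd ha (hi'.le.trans hb)
        refine (h0.smul _).mono ?_
        rw [hc i hi, mul_left_comm]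
        exact mul_le_mul_of_nonneg_left (key b i hi') (by positivity)
    refine (h1.add h2).mono ?_
    rw [Finset.card_range, Finset.card_range, ← add_mul]
    have ha' : (a : ℝ) ≤ N := by exact_mod_cast ha
    have hb' : (b : ℝ) ≤ N := by exact_mod_cast hb
    exact mul_le_mul_of_nonneg_right (by linarith) (by positivity)
  | zero => simpa using ProdBound.zero
  | add _ _ h1 h2 =>
    rw [derivative_add]; exact (h1.add h2).mono (le_of_eq (by ring))
  | smul c _ h =>
    rw [derivative_smul]; exact (h.smul c).mono (le_of_eq (by ring))
  | mono _ h ih => exact ih.mono (by gcongr)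

/-! ### Divided differences -/

section DividedDifference

variable {F : Type*} [Field F]

/-- The divided difference `(p(y) - p(x)) / (y - x)` as a polynomial in `y`. -/
def slopePoly (x : F) (p : F[X]) : F[X] := p /ₘ (X - C x)

theorem mul_slopePoly (x : F) (p : F[X]) : (X - C x) * slopePoly x p = p - C (p.eval x) := by
  have h := modByMonic_add_div p (X - C x)
  rw [modByMonic_X_sub_C_eq_C_eval] at h
  rw [slopePoly]
  linear_combination h

theorem slopePoly_eq {x : F} {p q : F[X]} (h : (X - C x) * q = p - C (p.eval x)) :
    slopePoly x p = q :=
  mul_left_cancel₀ (X_sub_C_ne_zero x) ((mul_slopePoly x p).trans h.symm)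

theorem slopePoly_X_add_C_mul (x c : F) (p : F[X]) :
    slopePoly x ((X + C c) * p) = p + (x + c) • slopePoly x p := by
  apply slopePoly_eq
  rw [mul_add, mul_smul_comm, mul_slopePoly, smul_eq_C_mul]
  simp
  ring

theorem slopePoly_smul (x c : F) (p : F[X]) : slopePoly x (c • p) = c • slopePoly x p := by
  apply slopePoly_eq
  rw [mul_smul_comm, mul_slopePoly, smul_sub, eval_smul, smul_C]

theorem slopePoly_sum {ι : Type*} (s : Finset ι) (x : F) (p : ι → F[X]) :
    slopePoly x (∑ i ∈ s, p i) = ∑ i ∈ s, slopePoly x (p i) := by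
  apply slopePoly_eq
  simp only [Finset.mul_sum, mul_slopePoly, Finset.sum_sub_distrib, eval_finsetSum, map_sum]

theorem slopePoly_pow (x : F) (p : F[X]) (n : ℕ) :
    slopePoly x (p ^ n) =
      ∑ i ∈ Finset.range n, (p.eval x) ^ (n - 1 - i) • (slopePoly x p * p ^ i) := by
  apply slopePoly_eq
  rw [eval_pow, C_pow, ← geom_sum₂_mul, Finset.mul_sum, Finset.sum_mul]
  refine Finset.sum_congr rfl fun i _ => ?_
  rw [mul_smul_comm, ← mul_assoc, mul_slopePoly, smul_eq_C_mul, C_pow]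
  ring

end DividedDifference

theorem abs_eval_binProd_le {x : ℝ} {h : ℕ} (hx : |x| ≤ h) (a b : ℕ) :
    |(binProd a b).eval x| ≤ (a + h).factorial * (b + h).factorial := by
  obtain ⟨hx1, hx2⟩ := abs_le.1 hx
  induction a with
  | zero =>
    induction b with
    | zero =>
      have : (1 : ℝ) ≤ h.factorial := by exact_mod_cast h.factorial_pos
      simp only [binProd_zero, eval_one, abs_one, zero_add]
      nlinarith
    | succ b ih =>
      rw [binProd_succ_right, eval_mul, abs_mul, add_right_comm b 1 h, Nat.factorial_succ]
      have : |(X - C (b : ℝ)).eval x| ≤ (b : ℝ) + h + 1 := by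
        rw [eval_sub, eval_X, eval_C, abs_le]; constructor <;> linarith [b.cast_nonneg (α := ℝ)]
      push_cast
      calc _ ≤ ((b : ℝ) + h + 1) * ((0 + h).factorial * (b + h).factorial) := by gcongr
        _ = _ := by ring
  | succ a ih =>
      rw [binProd_succ_left, eval_mul, abs_mul, add_right_comm a 1 h, Nat.factorial_succ]
      have : |(X + C ((a : ℝ) + 1)).eval x| ≤ (a : ℝ) + h + 1 := by
        rw [eval_add, eval_X, eval_C, abs_le]; constructor <;> linarith [a.cast_nonneg (α := ℝ)]
      push_cast
      calc _ ≤ ((a : ℝ) + h + 1) * ((a + h).factorial * (b + h).factorial) := by gcongr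
        _ = _ := by ring

/-- By the product rule, peeling off one linear factor gives a smaller `binProd` plus the value of
that factor at `x` times the smaller divided difference. That value is at most the next factor of
`(a + h)!` or `(b + h)!`, and each peeling adds one unit to `a + b`. -/
theorem prodBound_slopePoly_binProd {x : ℝ} {h : ℕ} (hx : |x| ≤ h) {N a b : ℕ} (ha : a ≤ N)
    (hb : b ≤ N) : ProdBound N ((a + h).factorial * (b + h).factorial * (a + b))
      (slopePoly x (binProd a b)) := by
  obtain ⟨hx1, hx2⟩ := abs_le.1 hx
  have hf : ∀ k : ℕ, (k.factorial : ℝ) ≤ (k + 1 + h).factorial := fun k => by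
    exact_mod_cast Nat.factorial_le (by omega)
  have hf' : ∀ k : ℕ, (k.factorial : ℝ) ≤ (k + h).factorial := fun k => by
    exact_mod_cast Nat.factorial_le (by omega)
  induction a with
  | zero =>
    induction b with
    | zero =>
      have : slopePoly x (binProd 0 0) = 0 := slopePoly_eq (by simp [binProd_zero])
      rw [this]; exact ProdBound.zero.mono (by simp)
    | succ b ih =>
      have e : X - C (b : ℝ) = X + C (-(b : ℝ)) := by rw [C_neg, sub_eq_add_neg]
      rw [binProd_succ_right, e, slopePoly_X_add_C_mul]
      have h1 : ProdBound N _ _ := .binProd ha (Nat.le_of_succ_le hb)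
      refine (h1.add ((ih (Nat.le_of_succ_le hb)).smul (x + -b))).mono ?_
      have h2 : |x + -(b : ℝ)| ≤ b + h + 1 := by
        rw [abs_le]; constructor <;> linarith [b.cast_nonneg (α := ℝ)]
      have h3 : ((b + 1 + h).factorial : ℝ) = (b + h + 1) * (b + h).factorial := by
        rw [add_right_comm b 1 h, Nat.factorial_succ]; push_cast; ring
      calc _ ≤ ((0 + h).factorial : ℝ) * (b + 1 + h).factorial + (b + h + 1) *
            ((0 + h).factorial * (b + h).factorial * ((0 : ℕ) + b)) := by
              exact add_le_add (mul_le_mul (hf' 0) (hf b) (by positivity) (by positivity))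
                (mul_le_mul_of_nonneg_right h2 (by positivity))
        _ = _ := by rw [h3]; push_cast; ring
  | succ a ih =>
      rw [binProd_succ_left, slopePoly_X_add_C_mul]
      have h1 : ProdBound N _ _ := .binProd (Nat.le_of_succ_le ha) hb
      refine (h1.add ((ih (Nat.le_of_succ_le ha)).smul (x + (a + 1)))).mono ?_
      have h2 : |x + ((a : ℝ) + 1)| ≤ a + h + 1 := by
        rw [abs_le]; constructor <;> linarith [a.cast_nonneg (α := ℝ)]
      have h3 : ((a + 1 + h).factorial : ℝ) = (a + h + 1) * (a + h).factorial := by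
        rw [add_right_comm a 1 h, Nat.factorial_succ]; push_cast; ring
      calc _ ≤ ((a + 1 + h).factorial : ℝ) * (b + h).factorial + (a + h + 1) *
            ((a + h).factorial * (b + h).factorial * (a + b)) := by
              exact add_le_add (mul_le_mul (hf a) (hf' b) (by positivity) (by positivity))
                (mul_le_mul_of_nonneg_right h2 (by positivity))
        _ = _ := by rw [h3]; push_cast; ring

/-! ### Polynomial bounds for the individual summands -/

/-- A bound for a functional on the images under `mellinPoly` of products with powers of
binomial coefficients. -/
def MellinBounded (J : ℝ[X] →ₗ[ℝ] ℝ) (W : ℝ) : Prop :=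
  ∀ ⦃N : ℕ⦄ ⦃K : ℝ⦄ ⦃p : ℝ[X]⦄, ProdBound N K p → ∀ (j k i : ℕ), i ≤ 2 →
    |J (mellinPoly (p * binomShift j k ^ i))| ≤ (W + 4 * N + 1) * K

theorem ProdBound.abs_eval_mul_le {N : ℕ} {K : ℝ} {p : ℝ[X]} (h : ProdBound N K p) (j k : ℕ)
    {i : ℕ} (hi : i ≤ 2) {u : ℝ} (hu : u ∈ Set.Icc (-1 : ℝ) 0) :
    |(mellinPolyAdj p * mellinPoly (binomShift j k ^ i)).eval u| ≤ K := by
  rw [eval_mul, abs_mul, ← mul_one K]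
  exact mul_le_mul (h.abs_eval_mellinPolyAdj_le hu)
    (abs_eval_mellinPoly_binomShift_pow_le j k hi hu) (abs_nonneg _) h.nonneg

theorem mellinBounded_unitInt : MellinBounded unitInt 0 := by
  intro N K p hp j k i hi
  rw [unitInt_mellinPoly_mul]
  refine (abs_unitInt_le fun u hu => hp.abs_eval_mul_le j k hi hu).trans ?_
  have : 0 ≤ (N : ℝ) * K := mul_nonneg N.cast_nonneg hp.nonneg
  linarith

theorem mellinBounded_logInt : MellinBounded logInt (∫ u in (-1 : ℝ)..0, |logWeight u|) := by
  intro N K p hp j k i hi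
  rw [logInt_mellinPoly_mul]
  have h1 := abs_logInt_le fun u hu => hp.abs_eval_mul_le j k hi hu
  have h2 := abs_unitInt_le fun u hu => hp.derivative.abs_eval_mul_le j k hi hu
  have h3 := hp.nonneg
  refine (abs_add_le _ _).trans ?_
  rw [abs_mul, abs_two]
  linarith

theorem factorial_add_le (a h : ℕ) {τ : ℝ} (hτ : ((a + h : ℕ) : ℝ) ≤ τ) :
    ((a + h).factorial : ℝ) ≤ a.factorial * τ ^ h := by
  rw [← Nat.factorial_mul_ascFactorial]
  push_cast
  gcongr
  calc (((a + 1).ascFactorial h : ℕ) : ℝ) ≤ ((a + h : ℕ) : ℝ) ^ h := by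
        exact_mod_cast Nat.ascFactorial_le_pow_add a h
    _ ≤ τ ^ h := by gcongr

/-- The central cancellation: at `h = 0` the left side is exactly `1`, and each of the two shifts by
`h` costs at most `τ ^ h`. -/
theorem choose_mul_factorial_add_le (j k h : ℕ) {τ : ℝ} (hτ : ((j + k + h : ℕ) : ℝ) ≤ τ) :
    ((j + k).choose j : ℝ) * (((j + k).factorial : ℝ)⁻¹ *
      ((j + h).factorial * (k + h).factorial)) ≤ τ ^ (2 * h) := by
  have h1 := factorial_add_le j h (τ := τ) (le_trans (by exact_mod_cast (by omega)) hτ)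
  have h2 := factorial_add_le k h (τ := τ) (le_trans (by exact_mod_cast (by omega)) hτ)
  have hτ0 : 0 ≤ τ := (Nat.cast_nonneg _).trans hτ
  have hc : ((j + k).choose j : ℝ) * j.factorial * k.factorial = (j + k).factorial := by
    have := Nat.add_choose_mul_factorial_mul_factorial j k
    rw [← Nat.choose_symm_add] at this
    exact_mod_cast this
  calc _ ≤ ((j + k).choose j : ℝ) * (((j + k).factorial : ℝ)⁻¹ *
        ((j.factorial * τ ^ h) * (k.factorial * τ ^ h))) := by gcongr
    _ = ((j + k).factorial : ℝ)⁻¹ * (((j + k).choose j : ℝ) * j.factorial * k.factorial) *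
        τ ^ (2 * h) := by ring
    _ = τ ^ (2 * h) := by rw [hc, inv_mul_cancel₀ (by positivity), one_mul]

theorem choose_mul_abs_eval_binomShift_le {x : ℝ} {h : ℕ} (hx : |x| ≤ h) (j k : ℕ) {τ : ℝ}
    (hτ : ((j + k + h : ℕ) : ℝ) ≤ τ) :
    ((j + k).choose j : ℝ) * |(binomShift j k).eval x| ≤ τ ^ (2 * h) := by
  refine le_trans ?_ (choose_mul_factorial_add_le j k h hτ)
  rw [binomShift, eval_smul, smul_eq_mul, abs_mul, abs_of_nonneg (by positivity)]
  gcongr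
  exact abs_eval_binProd_le hx j k

theorem one_le_choose (j k : ℕ) : (1 : ℝ) ≤ (j + k).choose j := by
  exact_mod_cast Nat.choose_pos (Nat.le_add_right j k)

theorem abs_eval_binomShift_le {x : ℝ} {h : ℕ} (hx : |x| ≤ h) (j k : ℕ) {τ : ℝ}
    (hτ : ((j + k + h : ℕ) : ℝ) ≤ τ) : |(binomShift j k).eval x| ≤ τ ^ (2 * h) :=
  (le_mul_of_one_le_left (abs_nonneg _) (one_le_choose j k)).trans
    (choose_mul_abs_eval_binomShift_le hx j k hτ)

/-- The product `(y + j) (y + j - 1) ⋯ (y + j - l + 1)`. -/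
def fallProd (j l : ℕ) : ℝ[X] := ∏ i ∈ Finset.range l, (X + C ((j : ℝ) - i))

theorem fallProd_succ (j l : ℕ) : fallProd j (l + 1) = (X + C ((j : ℝ) - l)) * fallProd j l := by
  rw [fallProd, Finset.prod_range_succ, mul_comm]; rfl

theorem abs_sub_le_add (j l : ℕ) : |(j : ℝ) - l| ≤ j + l := by
  rw [abs_le]; constructor <;> linarith [j.cast_nonneg (α := ℝ), l.cast_nonneg (α := ℝ)]

theorem abs_eval_fallProd_le {x : ℝ} {h : ℕ} (hx : |x| ≤ h) (j : ℕ) {l L : ℕ} (hl : l ≤ L) {τ : ℝ}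
    (hτ : ((j + L + h : ℕ) : ℝ) ≤ τ) : |(fallProd j l).eval x| ≤ τ ^ l := by
  rw [fallProd, eval_prod, Finset.abs_prod]
  refine (Finset.prod_le_prod (g := fun _ => τ) (fun _ _ => abs_nonneg _)
    fun i hi => ?_).trans_eq (by simp)
  rw [eval_add, eval_X, eval_C]
  have hi : (i : ℝ) ≤ L := by exact_mod_cast (Finset.mem_range.1 hi).le.trans hl
  push_cast at hτ
  linarith [abs_add_le x ((j : ℝ) - i), abs_sub_le_add j i]

theorem prodBound_fallProd_mul (j k : ℕ) {l L : ℕ} (hl : l ≤ L) {τ : ℝ}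
    (hτ : 4 * ((j : ℝ) + k + L) + 1 ≤ τ) :
    ∃ K, ProdBound (j + k + l) K (fallProd j l * binomShift j k) ∧
      ((j + k).choose j : ℝ) * K ≤ τ ^ l := by
  induction l with
  | zero =>
    have h1 : ProdBound (j + k) _ _ := .binProd (Nat.le_add_right j k) (Nat.le_add_left k j)
    refine ⟨_, by simpa [fallProd, binomShift] using h1.smul ((j + k).factorial : ℝ)⁻¹, ?_⟩
    have := choose_mul_factorial_add_le j k 0 (τ := τ) (by
      push_cast
      linarith [j.cast_nonneg (α := ℝ), k.cast_nonneg (α := ℝ), L.cast_nonneg (α := ℝ)])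
    simpa using this
  | succ l ih =>
    obtain ⟨K, hK, hle⟩ := ih (Nat.le_of_succ_le hl)
    rw [fallProd_succ, mul_assoc]
    refine ⟨_, hK.X_add_C_mul _, ?_⟩
    have h1 := abs_sub_le_add j l
    have h2 : (l : ℝ) + 1 ≤ L := by exact_mod_cast hl
    have hp := j.cast_nonneg (α := ℝ)
    have hq := k.cast_nonneg (α := ℝ)
    have hl0 := l.cast_nonneg (α := ℝ)
    have h3 : 2 * ((j + k + l : ℕ) : ℝ) + 1 + |(j : ℝ) - l| ≤ τ := by
      push_cast; linarith
    have hτ0 : 0 ≤ τ := by linarith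
    have hK0 := hK.nonneg
    calc _ = (2 * ((j + k + l : ℕ) : ℝ) + 1 + |(j : ℝ) - l|) * (((j + k).choose j : ℝ) * K) := by
          ring
      _ ≤ τ * τ ^ l := by gcongr
      _ = _ := by ring

/-- The exponent `6h + 2` collects `4h` from at most two values of `binomShift` at `x`, `2h` from
the shifted factorials, and one `τ` each from `MellinBounded` and from the factor `j + k`. The
constant `3` bounds the number `r + 1` of terms. -/
theorem choose_mul_abs_slopePoly_pow_le {J : ℝ[X] →ₗ[ℝ] ℝ} {W : ℝ} (hJ : MellinBounded J W)
    (hW : 0 ≤ W) {x : ℝ} {h : ℕ} (hx : |x| ≤ h) {r : ℕ} (hr : r ≤ 2) (j k : ℕ) {τ : ℝ}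
    (hτ : 4 * ((j : ℝ) + k) + W + h + 2 ≤ τ) :
    ((j + k).choose j : ℝ) *
      |J (mellinPoly (slopePoly x (binomShift j k ^ (r + 1))))| ≤ 3 * τ ^ (6 * h + 2) := by
  have hj0 := j.cast_nonneg (α := ℝ)
  have hk0 := k.cast_nonneg (α := ℝ)
  have hh0 := h.cast_nonneg (α := ℝ)
  have hτ1 : 1 ≤ τ := by linarith
  have hτ0 : 0 ≤ τ := by linarith
  have hτ2 : ((j + k + h : ℕ) : ℝ) ≤ τ := by push_cast; linarith
  have hs := (prodBound_slopePoly_binProd hx (N := j + k) (Nat.le_add_right j k)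
    (Nat.le_add_left k j)).smul ((j + k).factorial : ℝ)⁻¹
  rw [← slopePoly_smul, ← binomShift] at hs
  have hf := abs_eval_binomShift_le hx j k hτ2
  have hterm : ∀ i ∈ Finset.range (r + 1), ((j + k).choose j : ℝ) *
      |J (mellinPoly ((binomShift j k).eval x ^ (r + 1 - 1 - i) •
        (slopePoly x (binomShift j k) * binomShift j k ^ i)))| ≤ τ ^ (6 * h + 2) := by
    intro i hi
    have hi' : i ≤ r := Nat.lt_succ_iff.1 (Finset.mem_range.1 hi)
    rw [mellinPoly_smul, map_smul, smul_eq_mul, abs_mul, abs_pow]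
    have h1 : |(binomShift j k).eval x| ^ (r + 1 - 1 - i) ≤ τ ^ (4 * h) := by
      calc _ ≤ (τ ^ (2 * h)) ^ (r + 1 - 1 - i) := by gcongr
        _ = τ ^ (2 * h * (r + 1 - 1 - i)) := (pow_mul _ _ _).symm
        _ ≤ τ ^ (4 * h) := by
          refine pow_le_pow_right₀ hτ1 ?_
          calc 2 * h * (r + 1 - 1 - i) ≤ 2 * h * 2 := Nat.mul_le_mul_left _ (by omega)
            _ = 4 * h := by ring
    have h2 := hJ hs j k i (hi'.trans hr)
    have h3 := choose_mul_factorial_add_le j k h hτ2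
    rw [abs_of_nonneg (by positivity : (0 : ℝ) ≤ ((j + k).factorial : ℝ)⁻¹)] at h2
    have h4 : W + 4 * ((j + k : ℕ) : ℝ) + 1 ≤ τ := by push_cast; linarith
    have h5 : (j : ℝ) + k ≤ τ := by linarith
    calc _ ≤ ((j + k).choose j : ℝ) * (τ ^ (4 * h) * (τ * (((j + k).factorial : ℝ)⁻¹ *
          ((j + h).factorial * (k + h).factorial * τ)))) := by
            gcongr
            refine h2.trans ?_
            gcongr
      _ = τ ^ (4 * h) * (τ * τ) * (((j + k).choose j : ℝ) * (((j + k).factorial : ℝ)⁻¹ *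
          ((j + h).factorial * (k + h).factorial))) := by ring
      _ ≤ τ ^ (4 * h) * (τ * τ) * τ ^ (2 * h) := by gcongr
      _ = _ := by ring
  have hsum : mellinPoly (slopePoly x (binomShift j k ^ (r + 1))) =
      ∑ i ∈ Finset.range (r + 1), mellinPoly ((binomShift j k).eval x ^ (r + 1 - 1 - i) •
        (slopePoly x (binomShift j k) * binomShift j k ^ i)) := by
    rw [slopePoly_pow]
    simp only [mellinPoly, map_sum, LinearMap.sum_apply]
  rw [hsum, map_sum]
  calc _ ≤ ((j + k).choose j : ℝ) * ∑ i ∈ Finset.range (r + 1),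
        |J (mellinPoly ((binomShift j k).eval x ^ (r + 1 - 1 - i) •
          (slopePoly x (binomShift j k) * binomShift j k ^ i)))| := by
          gcongr
          exact Finset.abs_sum_le_sum_abs _ _
    _ ≤ ∑ i ∈ Finset.range (r + 1), τ ^ (6 * h + 2) := by
          rw [Finset.mul_sum]; exact Finset.sum_le_sum hterm
    _ ≤ 3 * τ ^ (6 * h + 2) := by
          rw [Finset.sum_const, Finset.card_range, nsmul_eq_mul]
          have : ((r + 1 : ℕ) : ℝ) ≤ 3 := by exact_mod_cast (by omega : r + 1 ≤ 3)
          gcongr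

theorem choose_mul_abs_slopePoly_le {J : ℝ[X] →ₗ[ℝ] ℝ} {W : ℝ} (hJ : MellinBounded J W)
    (hW : 0 ≤ W) {x : ℝ} {h : ℕ} (hx : |x| ≤ h) {r : ℕ} (hr : r ≤ 2) (j k : ℕ) {l L : ℕ}
    (hl : l ≤ L) {τ : ℝ} (hτ : 4 * ((j : ℝ) + k + L) + W + h + 2 ≤ τ) :
    ((j + k).choose j : ℝ) *
      |J (mellinPoly (slopePoly x (fallProd j l * binomShift j k ^ (r + 1))))| ≤
        (3 + l) * τ ^ (6 * h + 2 + l) := by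
  have hj0 := j.cast_nonneg (α := ℝ)
  have hk0 := k.cast_nonneg (α := ℝ)
  have hh0 := h.cast_nonneg (α := ℝ)
  have hL0 := L.cast_nonneg (α := ℝ)
  have hτ1 : 1 ≤ τ := by linarith
  have hτ0 : 0 ≤ τ := by linarith
  induction l with
  | zero =>
    have := choose_mul_abs_slopePoly_pow_le hJ hW hx hr j k (τ := τ) (by linarith)
    simpa [fallProd] using this
  | succ l ih =>
    have hl' : (l : ℝ) + 1 ≤ L := by exact_mod_cast hl
    have hl0 := l.cast_nonneg (α := ℝ)
    obtain ⟨K, hK, hle⟩ := prodBound_fallProd_mul j k (Nat.le_of_succ_le hl) (τ := τ)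
      (by linarith)
    have h1 := hJ hK j k r hr
    rw [mul_assoc, ← pow_succ'] at h1
    have h2 : W + 4 * ((j + k + l : ℕ) : ℝ) + 1 ≤ τ := by push_cast; linarith
    have h3 : |x + ((j : ℝ) - l)| ≤ τ := by
      linarith [abs_add_le x ((j : ℝ) - l), abs_sub_le_add j l]
    have hK0 := hK.nonneg
    rw [fallProd_succ, mul_assoc, slopePoly_X_add_C_mul, mellinPoly_add, mellinPoly_smul,
      map_add, map_smul, smul_eq_mul]
    set a := J (mellinPoly (fallProd j l * binomShift j k ^ (r + 1)))
    set b := J (mellinPoly (slopePoly x (fallProd j l * binomShift j k ^ (r + 1))))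
    calc ((j + k).choose j : ℝ) * |a + (x + ((j : ℝ) - l)) * b|
        ≤ ((j + k).choose j : ℝ) * (τ * K + τ * |b|) := by
          gcongr
          refine (abs_add_le _ _).trans ?_
          rw [abs_mul]
          gcongr
          exact h1.trans (by gcongr)
      _ = τ * (((j + k).choose j : ℝ) * K) + τ * (((j + k).choose j : ℝ) * |b|) := by ring
      _ ≤ τ * τ ^ l + τ * ((3 + l) * τ ^ (6 * h + 2 + l)) := by
          exact add_le_add (mul_le_mul_of_nonneg_left hle hτ0)
            (mul_le_mul_of_nonneg_left (ih (Nat.le_of_succ_le hl)) hτ0)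
      _ ≤ τ ^ (6 * h + 2 + (l + 1)) + τ * ((3 + l) * τ ^ (6 * h + 2 + l)) := by
          gcongr
          rw [← pow_succ']
          exact pow_le_pow_right₀ hτ1 (by omega)
      _ = _ := by push_cast; ring

/-! ### Power series coefficients as moments -/

theorem constantCoeff_subst_exp_sub_one (g : PowerSeries ℚ) :
    PowerSeries.coeff 0 (g.subst (PowerSeries.exp ℚ - 1)) = PowerSeries.coeff 0 g := by
  have hs := PowerSeries.HasSubst.exp_sub_one (A := ℚ)
  have h0 : PowerSeries.constantCoeff (PowerSeries.exp ℚ - 1) = 0 := by simp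
  obtain ⟨g', hg', e⟩ : ∃ g' : PowerSeries ℚ, PowerSeries.constantCoeff g' = 0 ∧
      g = g' + PowerSeries.C (PowerSeries.constantCoeff g) :=
    ⟨g - PowerSeries.C (PowerSeries.constantCoeff g), by simp, by ring⟩
  have h1 := PowerSeries.constantCoeff_subst_eq_zero h0 g' hg'
  rw [e, PowerSeries.subst_add hs, PowerSeries.subst_C]
  simp only [map_add, PowerSeries.coeff_zero_eq_constantCoeff, hg', PowerSeries.constantCoeff_C]
  have h2 : PowerSeries.constantCoeff (PowerSeries.subst (PowerSeries.exp ℚ - 1) g') = 0 := h1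
  rw [h2]
  congr 1

theorem derivative_subst_exp_sub_one (g : PowerSeries ℚ) :
    PowerSeries.derivative ℚ (g.subst (PowerSeries.exp ℚ - 1)) =
      ((1 + PowerSeries.X) * PowerSeries.derivative ℚ g).subst (PowerSeries.exp ℚ - 1) := by
  have hs := PowerSeries.HasSubst.exp_sub_one (A := ℚ)
  have h1 : (1 : PowerSeries ℚ).subst (PowerSeries.exp ℚ - 1) = 1 := by
    rw [← PowerSeries.coe_substAlgHom hs, map_one]
  rw [PowerSeries.derivative_subst hs, PowerSeries.subst_mul hs, PowerSeries.subst_add hs, h1,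
    PowerSeries.subst_X hs, map_sub, PowerSeries.derivative_exp, Derivation.map_one_eq_zero]
  ring

theorem mellinOp_X_pow (i : ℕ) :
    mellinOp (X ^ i) = (i : ℝ) • X ^ i + ((i : ℝ) + 1) • X ^ (i + 1) := by
  have h := mellinOp_X_pow_mul 0 i 1
  simp only [pow_zero, mul_one, derivative_one, mul_zero, add_zero, Nat.cast_zero, zero_add,
    C_1, one_mul] at h
  rw [h, smul_eq_C_mul, smul_eq_C_mul, C_add, C_1]
  ring

/-- The exponential coefficients of `g(eᶻ - 1)` as moments. -/
theorem apply_mellinOp_pow (g : PowerSeries ℚ) (J : ℝ[X] →ₗ[ℝ] ℝ)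
    (h : ∀ i : ℕ, J (X ^ i) = ((PowerSeries.coeff i g : ℚ) : ℝ)) (k : ℕ) :
    J ((mellinOp ^ k) 1) = (((k.factorial : ℚ) *
      PowerSeries.coeff k (g.subst (PowerSeries.exp ℚ - 1)) : ℚ) : ℝ) := by
  induction k generalizing g J with
  | zero =>
    have := h 0
    simpa [constantCoeff_subst_exp_sub_one] using this
  | succ k ih =>
    -- Composing `J` with `mellinOp` replaces `g` by `(1 + z) g'`, just as differentiating `g(eᶻ -
    -- 1)` does.
    have h' : ∀ i : ℕ, (J ∘ₗ mellinOp) (X ^ i) =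
        ((PowerSeries.coeff i ((1 + PowerSeries.X) * PowerSeries.derivative ℚ g) : ℚ) : ℝ) := by
      intro i
      rw [LinearMap.comp_apply, mellinOp_X_pow, map_add, map_smul, map_smul, h, h, add_mul, one_mul,
        map_add, PowerSeries.coeff_derivative]
      rcases i with _ | i
      · simp
      · rw [PowerSeries.coeff_succ_X_mul, PowerSeries.coeff_derivative]
        push_cast
        simp only [smul_eq_mul]
        ring
    have := ih _ _ h'
    rw [LinearMap.comp_apply, ← Module.End.mul_apply, ← pow_succ'] at this
    rw [this, ← derivative_subst_exp_sub_one, PowerSeries.coeff_derivative, Nat.factorial_succ]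
    push_cast
    ring

theorem unitInt_X_pow_eq_coeff (i : ℕ) :
    unitInt (X ^ i) = ((PowerSeries.coeff i (divZ (PowerSeries.log ℚ)) : ℚ) : ℝ) := by
  rw [unitInt_X_pow, divZ, PowerSeries.coeff_mk, PowerSeries.coeff_log, if_neg i.succ_ne_zero]
  simp [pow_succ]

theorem one_add_X_mul_derivative_log_sq :
    (1 + PowerSeries.X) * PowerSeries.derivative ℚ (PowerSeries.log ℚ ^ 2) =
      2 * PowerSeries.log ℚ := by
  have h : (1 + PowerSeries.X) * PowerSeries.derivative ℚ (PowerSeries.log ℚ) = 1 := by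
    rw [PowerSeries.deriv_log]
    ext n
    rcases n with _ | n
    · simp [add_mul]
    · rw [add_mul, one_mul, map_add, PowerSeries.coeff_succ_X_mul]
      simp [pow_succ, PowerSeries.coeff_one]
  rw [pow_two, Derivation.leibniz, smul_eq_mul]
  linear_combination 2 * PowerSeries.log ℚ * h

theorem logInt_X_pow_eq_coeff (i : ℕ) :
    logInt (X ^ i) = ((PowerSeries.coeff i (divZ (PowerSeries.log ℚ ^ 2)) : ℚ) : ℝ) := by
  induction i with
  | zero =>
    rw [pow_zero, logInt_one, divZ, PowerSeries.coeff_mk, pow_two, PowerSeries.coeff_mul]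
    simp [Finset.Nat.antidiagonal_succ]
  | succ i ih =>
    have h1 := logInt_X_pow_succ i
    have h2 := congrArg (PowerSeries.coeff (i + 1)) one_add_X_mul_derivative_log_sq
    rw [add_mul, one_mul, map_add, PowerSeries.coeff_succ_X_mul, PowerSeries.coeff_derivative,
      PowerSeries.coeff_derivative, two_mul, map_add, PowerSeries.coeff_log,
      if_neg i.succ_ne_zero] at h2
    have h3 := congrArg (fun q : ℚ => (q : ℝ)) h2
    simp only [divZ, PowerSeries.coeff_mk] at ih ⊢
    rw [ih] at h1
    push_cast at h3
    have h4 : (i : ℝ) + 2 ≠ 0 := by positivity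
    apply mul_left_cancel₀ h4
    rw [pow_add _ (i + 1) 1, pow_add _ i 1, pow_one, mul_neg_one, mul_neg_one, neg_neg] at h3
    linear_combination h1 - h3

/-- The transform `phi` of an inverse Mellin transform, evaluated at `x`, as a functional of
`mellinPoly`. -/
theorem phi_invMellinT_eval (g : PowerSeries ℚ) (J : ℝ[X] →ₗ[ℝ] ℝ)
    (h : ∀ i : ℕ, J (X ^ i) = ((PowerSeries.coeff i g : ℚ) : ℝ)) (F : ℚ[X][X]) (x : ℚ) :
    (((phi (invMellinT g) F).eval x : ℚ) : ℝ) =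
      -J (mellinPoly (((F.map (evalRingHom x)).comp (-X)).map (algebraMap ℚ ℝ))) := by
  have key : ∀ k : ℕ, ((PowerSeries.coeff (k + 1) (invMellinT g) : ℚ) : ℝ) =
      -J (mellinPoly ((-X) ^ k)) := by
    intro k
    have e : mellinPoly ((-X) ^ k) = (-1 : ℝ) ^ k • (mellinOp ^ k) 1 := by
      rw [neg_pow, mellinPoly]
      have : ((-1) ^ k : ℝ[X]) = C ((-1) ^ k) := by simp
      rw [this, ← smul_eq_C_mul, map_smul]
      simp
    rw [e, map_smul, apply_mellinOp_pow g J h, invMellinT, PowerSeries.coeff_mk]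
    push_cast
    rw [pow_succ, smul_eq_mul]
    ring
  induction F using Polynomial.induction_on' with
  | add p q hp hq =>
    have e : phi (invMellinT g) (p + q) = phi (invMellinT g) p + phi (invMellinT g) q := by
      rw [phi, phi, phi, Polynomial.sum_add_index] <;> simp [smul_add]
    rw [e, eval_add, Rat.cast_add, hp, hq, Polynomial.map_add, add_comp, Polynomial.map_add,
      mellinPoly_add, map_add, neg_add]
  | monomial n a =>
    have e : ((((monomial n) a).map (evalRingHom x)).comp (-X)).map (algebraMap ℚ ℝ) =
        ((a.eval x : ℚ) : ℝ) • (-X) ^ n := by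
      rw [map_monomial, monomial_comp, Polynomial.map_mul, smul_eq_C_mul]
      simp
    rw [phi, Polynomial.sum_monomial_index _ _ (by simp), eval_smul, smul_eq_mul, Rat.cast_mul,
      key, e, mellinPoly_smul, map_smul, smul_eq_mul]
    ring

theorem map_divDiff (x : ℚ) (p : ℚ[X]) : (divDiff p).map (evalRingHom x) = slopePoly x p := by
  refine (slopePoly_eq ?_).symm
  have h := congrArg (Polynomial.map (evalRingHom x)) (mul_divDiff p)
  have e : (p.map C).map (evalRingHom x) = p := by
    rw [Polynomial.map_map]
    have : (evalRingHom x).comp C = RingHom.id ℚ := by ext; simp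
    rw [this, Polynomial.map_id]
  simpa [e] using h

theorem map_slopePoly_comp_neg (x : ℚ) (p : ℚ[X]) :
    ((slopePoly x p).comp (-X)).map (algebraMap ℚ ℝ) =
      -slopePoly (-(x : ℝ)) ((p.comp (-X)).map (algebraMap ℚ ℝ)) := by
  have h := congrArg (fun q : ℚ[X] => (q.comp (-X)).map (algebraMap ℚ ℝ)) (mul_slopePoly x p)
  rw [eq_neg_iff_add_eq_zero, add_comm, ← eq_neg_iff_add_eq_zero]
  refine slopePoly_eq ?_
  have e : ((p.comp (-X)).map (algebraMap ℚ ℝ)).eval (-(x : ℝ)) = ((p.eval x : ℚ) : ℝ) := by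
    have hx : -(x : ℝ) = algebraMap ℚ ℝ (-x) := by simp
    rw [hx, eval_map_apply, eval_comp]
    simp
  rw [e]
  simp only [sub_comp, mul_comp, X_comp, C_comp, Polynomial.map_mul, Polynomial.map_sub,
    Polynomial.map_neg, map_X, map_C, eq_ratCast] at h
  rw [← h]
  simp
  ring

/-! ### Explicit sums for `P` and `Q` -/

theorem iterate_delta (p : ℚ[X]) (n : ℕ) : delta^[n] p = ∑ j ∈ Finset.range (n + 1),
    ((-1) ^ (n - j) * (n.choose j : ℤ)) • p.comp (X - C (j : ℚ)) := by
  -- Viewed along the sequence `k ↦ p(z - k)`, `delta` is the ordinary forward difference.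
  have key : ∀ n : ℕ, (fwdDiff 1)^[n] (fun k : ℕ => p.comp (X - C (k : ℚ))) =
      fun k : ℕ => (delta^[n] p).comp (X - C (k : ℚ)) := by
    intro n
    induction n with
    | zero => rfl
    | succ n ih =>
      rw [Function.iterate_succ_apply', ih, Function.iterate_succ_apply']
      funext k
      rw [fwdDiff, delta, sub_comp, comp_assoc]
      congr 2
      simp
      ring
  have h := congrFun (key n) 0
  rw [fwdDiff_iter_eq_sum_shift] at h
  simpa using h.symm

theorem map_ascPochhammer_comp (j n : ℕ) :
    ((ascPochhammer ℚ n).comp (-X - C (j : ℚ))).map (algebraMap ℚ ℝ) =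
      (-1) ^ n * fallProd j n := by
  induction n with
  | zero => simp [fallProd]
  | succ n ih =>
    rw [ascPochhammer_succ_right, mul_comp, Polynomial.map_mul, ih, fallProd_succ]
    simp
    ring

theorem fallProd_add (j k : ℕ) : fallProd j (j + k) = binProd j k := by
  rw [fallProd, Finset.prod_range_add, binProd, ← Finset.prod_range_reflect]
  congr 1
  · refine Finset.prod_congr rfl fun i hi => ?_
    have hi' := Finset.mem_range.1 hi
    rw [Nat.cast_sub (by omega), Nat.cast_sub (by omega)]
    congr 2
    push_cast; ring
  · refine Finset.prod_congr rfl fun i _ => ?_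
    push_cast
    rw [sub_eq_add_neg X, ← C_neg]
    congr 2
    ring

theorem map_A_comp (m α : Fin 1 → _) (hα : α 0 = 0) (j k l : ℕ) :
    (((A m α (j + k) l).comp (X - C (j : ℚ))).comp (-X)).map (algebraMap ℚ ℝ) =
      (l.factorial : ℝ)⁻¹ • (fallProd j l * binomShift j k ^ (m 0 + 1)) := by
  have e : (X - C (j : ℚ)).comp (-X) = -X - C (j : ℚ) := by simp
  have h1 := map_ascPochhammer_comp j l
  have h2 := map_ascPochhammer_comp j (j + k)
  rw [fallProd_add] at h2
  rw [comp_assoc, e, A, Fin.prod_univ_one, hα, C_0, add_zero, comp_X, mul_comp, mul_comp, pow_comp,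
    mul_comp, Polynomial.map_mul, Polynomial.map_mul, Polynomial.map_pow, Polynomial.map_mul, h1,
    h2, binomShift]
  have h3 : ∀ (a b : ℕ), ((C ((-1) ^ a / (b : ℚ))).comp (-X - C (j : ℚ))).map (algebraMap ℚ ℝ) *
      (-1) ^ a = C ((b : ℝ)⁻¹) := by
    intro a b
    rw [C_comp, map_C]
    have : ((-1) ^ a : ℝ[X]) = C ((-1) ^ a) := by simp
    rw [this, ← C_mul]
    congr 1
    simp only [eq_ratCast]
    push_cast
    rw [div_mul_eq_mul_div, ← mul_pow]
    simp
  rw [← mul_assoc, h3, ← mul_assoc, h3, smul_eq_C_mul, smul_eq_C_mul, mul_assoc]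

theorem map_P_comp (m α : Fin 1 → _) (hα : α 0 = 0) (n l : ℕ) :
    ((P m α n l).comp (-X)).map (algebraMap ℚ ℝ) = ∑ j ∈ Finset.range (n + 1),
      ((-1) ^ (n - j) * (n.choose j : ℝ) * (l.factorial : ℝ)⁻¹) •
        (fallProd j l * binomShift j (n - j) ^ (m 0 + 1)) := by
  rw [P, iterate_delta, sum_comp, Polynomial.map_sum]
  refine Finset.sum_congr rfl fun j hj => ?_
  have hj' : j + (n - j) = n := by have := Finset.mem_range.1 hj; omega
  have h := map_A_comp m α hα j (n - j) l
  rw [hj'] at h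
  rw [mul_smul (_ : ℝ) (l.factorial : ℝ)⁻¹, ← h, ← Int.cast_smul_eq_zsmul ℚ, smul_comp,
    Polynomial.map_smul, eq_ratCast]
  push_cast
  rfl

theorem P_eval (m α : Fin 1 → _) (hα : α 0 = 0) (n l : ℕ) (x : ℚ) :
    (((P m α n l).eval x : ℚ) : ℝ) = ∑ j ∈ Finset.range (n + 1),
      ((-1) ^ (n - j) * (n.choose j : ℝ) * (l.factorial : ℝ)⁻¹) *
        ((fallProd j l).eval (-(x : ℝ)) *
          (binomShift j (n - j)).eval (-(x : ℝ)) ^ (m 0 + 1)) := by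
  have h := congrArg (eval (algebraMap ℚ ℝ (-x))) (map_P_comp m α hα n l)
  rw [eval_map_apply, eval_comp, eval_finsetSum] at h
  simpa [eval_smul] using h

theorem Q_eval (m α : Fin 1 → _) (hα : α 0 = 0) (n s l : ℕ) (x : ℚ) (g : PowerSeries ℚ)
    (hg : R (α 0) s = invMellinT g) (J : ℝ[X] →ₗ[ℝ] ℝ)
    (h : ∀ i : ℕ, J (X ^ i) = ((PowerSeries.coeff i g : ℚ) : ℝ)) :
    (((Q m α n 0 s l).eval x : ℚ) : ℝ) = ∑ j ∈ Finset.range (n + 1),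
      ((-1) ^ (n - j) * (n.choose j : ℝ) * (l.factorial : ℝ)⁻¹) *
        J (mellinPoly (slopePoly (-(x : ℝ))
          (fallProd j l * binomShift j (n - j) ^ (m 0 + 1)))) := by
  have hneg : ∀ p : ℝ[X], -J (mellinPoly (-p)) = J (mellinPoly p) := by
    intro p
    simp [mellinPoly]
  rw [Q, hg, phi_invMellinT_eval g J h, map_divDiff, map_slopePoly_comp_neg, hneg,
    map_P_comp m α hα, slopePoly_sum]
  simp only [mellinPoly, slopePoly_smul, map_sum, LinearMap.sum_apply, map_smul,
    LinearMap.smul_apply, smul_eq_mul]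

/-! ### From polynomial growth to the limsup -/

theorem limsup_rpow_le_one {a : ℕ → ℚ} {T : ℝ} (hT : 1 ≤ T) (D : ℕ)
    (h : ∀ n, |((a n : ℚ) : ℝ)| ≤ (4 * n + T) ^ D) :
    Filter.limsup (fun n : ℕ => ((((|a n| : ℚ) : ℝ) ^ (1 / (n : ℝ)) : ℝ) : EReal))
      Filter.atTop ≤ 1 := by
  have ht : Filter.Tendsto (fun n : ℕ => ((4 * n + T : ℝ) ^ (1 / (n : ℝ)))) Filter.atTop
      (nhds 1) := by
    -- At `t = 4n + T` the denominator `t / 4 - T / 4` equals `n`.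
    have h1 := tendsto_rpow_div_mul_add 1 (1 / 4) (-T / 4) (by norm_num)
    have h2 : Filter.Tendsto (fun n : ℕ => (4 * n + T : ℝ)) Filter.atTop Filter.atTop :=
      Filter.tendsto_atTop_add_const_right _ _
        (tendsto_natCast_atTop_atTop.const_mul_atTop (by norm_num))
    refine (h1.comp h2).congr fun n => ?_
    simp only [Function.comp_apply]
    congr 2
    ring
  have ht' : Filter.Tendsto (fun n : ℕ => ((((4 * n + T : ℝ) ^ (1 / (n : ℝ))) ^ D : ℝ) : EReal))
      Filter.atTop (nhds 1) := by
    have := (continuous_coe_real_ereal.tendsto _).comp (ht.pow D)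
    rwa [one_pow, EReal.coe_one] at this
  rw [← ht'.limsup_eq]
  refine Filter.limsup_le_limsup (.of_forall fun n => ?_)
  have h0 : (0 : ℝ) ≤ 4 * n + T := by positivity
  rw [EReal.coe_le_coe_iff, ← Real.rpow_natCast, ← Real.rpow_mul h0, mul_comm (1 / (n : ℝ)),
    Real.rpow_mul h0, Real.rpow_natCast]
  exact Real.rpow_le_rpow (by positivity) (by exact_mod_cast h n) (by positivity)

theorem abs_sum_choose_mul_le {n l : ℕ} {b : ℕ → ℝ} {K : ℝ}
    (h : ∀ j ≤ n, (n.choose j : ℝ) * |b j| ≤ K) :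
    |∑ j ∈ Finset.range (n + 1),
      ((-1) ^ (n - j) * (n.choose j : ℝ) * (l.factorial : ℝ)⁻¹) * b j| ≤ (n + 1) * K := by
  refine (Finset.abs_sum_le_sum_abs _ _).trans ((Finset.sum_le_card_nsmul _ _ K ?_).trans_eq ?_)
  · intro j hj
    have hj' : j ≤ n := Nat.lt_succ_iff.1 (Finset.mem_range.1 hj)
    have hl : (l.factorial : ℝ)⁻¹ ≤ 1 := inv_le_one_of_one_le₀ (by exact_mod_cast l.factorial_pos)
    refine le_trans ?_ (h j hj')
    rw [abs_mul, abs_mul, abs_mul, abs_pow, abs_neg, abs_one, one_pow, one_mul, Nat.abs_cast,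
      abs_of_nonneg (by positivity : (0 : ℝ) ≤ (l.factorial : ℝ)⁻¹)]
    refine mul_le_mul_of_nonneg_right ?_ (abs_nonneg _)
    exact mul_le_of_le_one_right (by positivity) hl
  · simp

theorem limsup_P_le_one (m α : Fin 1 → _) (hα : α 0 = 0) (hm : m 0 ≤ 2) (x : ℚ) (l : ℕ) :
    Filter.limsup (fun n : ℕ =>
        ((((|(P m α n l).eval x| : ℚ) : ℝ) ^ (1 / (n : ℝ)) : ℝ) : EReal)) Filter.atTop ≤ 1 := by
  obtain ⟨h, hh⟩ := exists_nat_ge |(-(x : ℝ))|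
  have hh0 := h.cast_nonneg (α := ℝ)
  have hl0 := l.cast_nonneg (α := ℝ)
  refine limsup_rpow_le_one (T := l + h + 1) (by linarith) (l + 6 * h + 1) fun n => ?_
  rw [P_eval m α hα]
  set τ : ℝ := 4 * n + (l + h + 1)
  have hn0 := n.cast_nonneg (α := ℝ)
  have hτ1 : 1 ≤ τ := by linarith
  have hτ2 : (n : ℝ) + 1 ≤ τ := by linarith
  have hτ0 : 0 ≤ τ := by linarith
  refine (abs_sum_choose_mul_le (K := τ ^ (l + 6 * h)) fun j hj => ?_).trans ?_
  · obtain ⟨k, rfl⟩ := Nat.exists_eq_add_of_le hj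
    rw [Nat.add_sub_cancel_left]
    have hj0 := j.cast_nonneg (α := ℝ)
    have hk0 := k.cast_nonneg (α := ℝ)
    push_cast at hτ2
    have hjk : τ = 4 * ((j : ℝ) + k) + (l + h + 1) := by simp [τ]
    have h1 := abs_eval_fallProd_le hh j (le_refl l) (τ := τ) (by push_cast; linarith)
    have h2 := choose_mul_abs_eval_binomShift_le hh j k (τ := τ) (by push_cast; linarith)
    have h3 := abs_eval_binomShift_le hh j k (τ := τ) (by push_cast; linarith)
    rw [abs_mul, abs_pow, pow_succ]
    calc _ = |(fallProd j l).eval (-(x : ℝ))| * |(binomShift j k).eval (-(x : ℝ))| ^ m 0 *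
          (((j + k).choose j : ℝ) * |(binomShift j k).eval (-(x : ℝ))|) := by ring
      _ ≤ τ ^ l * (τ ^ (2 * h)) ^ m 0 * τ ^ (2 * h) := by gcongr
      _ = τ ^ (l + 2 * h * m 0 + 2 * h) := by ring
      -- `m 0 ≤ 2` gives at most three factors `τ ^ (2h)`.
      _ ≤ τ ^ (l + 6 * h) := pow_le_pow_right₀ hτ1 (by nlinarith)
  · rw [pow_succ' τ]
    gcongr

theorem limsup_Q_le_one (m α : Fin 1 → _) (hα : α 0 = 0) (hm : m 0 ≤ 2) (x : ℚ) (s l : ℕ)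
    (g : PowerSeries ℚ) (hg : R (α 0) s = invMellinT g) (J : ℝ[X] →ₗ[ℝ] ℝ)
    (h : ∀ i : ℕ, J (X ^ i) = ((PowerSeries.coeff i g : ℚ) : ℝ)) {W : ℝ} (hW : 0 ≤ W)
    (hJ : MellinBounded J W) :
    Filter.limsup (fun n : ℕ =>
        ((((|(Q m α n 0 s l).eval x| : ℚ) : ℝ) ^ (1 / (n : ℝ)) : ℝ) : EReal))
      Filter.atTop ≤ 1 := by
  obtain ⟨b, hb⟩ := exists_nat_ge |(-(x : ℝ))|
  have hb0 := b.cast_nonneg (α := ℝ)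
  have hl0 := l.cast_nonneg (α := ℝ)
  refine limsup_rpow_le_one (T := 5 * l + W + b + 3) (by linarith) (6 * b + 2 + l + 1 + 1)
    fun n => ?_
  rw [Q_eval m α hα n s l x g hg J h]
  set τ : ℝ := 4 * n + (5 * l + W + b + 3)
  have hn0 := n.cast_nonneg (α := ℝ)
  have hτ2 : (n : ℝ) + 1 ≤ τ := by linarith
  have hτ3 : 3 + (l : ℝ) ≤ τ := by linarith
  have hτ0 : 0 ≤ τ := by linarith
  refine (abs_sum_choose_mul_le (K := τ ^ (6 * b + 2 + l + 1)) fun j hj => ?_).trans ?_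
  · obtain ⟨k, rfl⟩ := Nat.exists_eq_add_of_le hj
    rw [Nat.add_sub_cancel_left]
    have hjk : τ = 4 * ((j : ℝ) + k) + (5 * l + W + b + 3) := by simp [τ]
    refine (choose_mul_abs_slopePoly_le hJ hW hb hm j k (le_refl l) (τ := τ)
      (by linarith)).trans ?_
    rw [pow_succ' τ]
    gcongr
  · rw [pow_succ' τ (6 * b + 2 + l + 1)]
    gcongr

end

end PolygammaPade

theorem mainTheorem9 (d : ℕ) [NeZero d] (m : Fin d → ℕ) (hm : ∀ i, 1 ≤ m i)
    (α : Fin d → ℚ) (hα : α 0 = 0) (hM : PolygammaPade.bigM m ≤ 2) (x : ℚ)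
    (i : Fin d) (s : ℕ) (his : (i, s) ∈ PolygammaPade.indexSet m)
    (l : ℕ) (hl : l ≤ PolygammaPade.bigM m) :
    Filter.limsup (fun n : ℕ =>
        ((((|(PolygammaPade.P m α n l).eval x| : ℚ) : ℝ) ^ (1 / (n : ℝ)) : ℝ) : EReal))
      Filter.atTop ≤ 1 ∧
    Filter.limsup (fun n : ℕ =>
        ((((|(PolygammaPade.Q m α n i s l).eval x| : ℚ) : ℝ) ^ (1 / (n : ℝ)) : ℝ) : EReal))
      Filter.atTop ≤ 1 := by
  open PolygammaPade in
  have hsum : d ≤ ∑ i, m i := by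
    simpa using Finset.card_nsmul_le_sum Finset.univ m 1 fun i _ => hm i
  have hd0 : 0 < d := Nat.pos_of_neZero d
  obtain rfl : d = 1 := by
    rw [bigM] at hM
    omega
  obtain rfl : i = 0 := Subsingleton.elim _ _
  have hm0 : m 0 ≤ 2 := by simpa [bigM] using hM
  have hα0 : α (0 : Fin 1) = 0 := by
    rw [← hα]
  -- The removed index `(1, 1)` is the only one with `s = 1` when `d = 1`, so only `log` and `log²`
  -- occur.
  have hs : s = 2 ∨ s = 3 := by
    obtain ⟨h1, h2, h3⟩ := his
    have h4 : s ≠ 1 := by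
      rintro rfl
      exact h3 (by ext <;> simp)
    simp only at h1 h2
    omega
  refine ⟨limsup_P_le_one m α hα0 hm0 x l, ?_⟩
  rcases hs with rfl | rfl
  · refine limsup_Q_le_one m α hα0 hm0 x 2 l (divZ (PowerSeries.log ℚ)) ?_ unitInt
      unitInt_X_pow_eq_coeff le_rfl mellinBounded_unitInt
    rw [hα0, R, if_neg (by norm_num), PowerSeries.binomialSeries_zero]
    simp
  · refine limsup_Q_le_one m α hα0 hm0 x 3 l (divZ (PowerSeries.log ℚ ^ 2)) ?_ logInt
      logInt_X_pow_eq_coeff ?_ mellinBounded_logInt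
    · rw [hα0, R, if_neg (by norm_num), PowerSeries.binomialSeries_zero]
      simp
    · exact intervalIntegral.integral_nonneg (by norm_num) fun _ _ => abs_nonneg _
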